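/- \textbf{Stability of phase shifts in central-potential scattering.} Let $M>0$, let $k\in\mathbb R^3\setminus\{0\}$, put $E=\frac{|k|^2}{2M}$, and let $V$ be a real, spherically symmetric potential on $\mathbb R^3$ that is locally integrable and satisfies $V(r)=O(e^{-r/R_0})$ as $r\to\infty$ for some $R_0>0$. Let $\hat H=-\frac{\nabla^2}{2M}+V$, acting in the sense of distributions. Write $r=|x|$, let $\theta$ be the angle between $x$ and $k$, and let $P_\ell$ denote the Legendre polynomials. Let $\psi,\tilde\psi:\mathbb R^3\to\mathbb C$ be continuous functions with, as $r\to\infty$ uniformly in direction, $$\psi(x)=e^{ik\cdot x}+\frac{e^{i|k|r}}{r}f(\cos\theta)+O(r^{-2}),\qquad \tilde\psi(x)=e^{ik\cdot x}+\frac{e^{i|k|r}}{r}\tilde f(\cos\theta)+O(r^{-2}),$$ where $f,\tilde f:[-1,1]\to\mathbb C$. Suppose that $\psi$ is an exact scattering state, $(E-\hat H)\psi=0$, and that the Schr\"odinger violation $(E-\hat H)\tilde\psi$ is a locally integrable function. Decompose the outgoing amplitudes into partial waves, with convergence in mean square, $$f(\cos\theta)=\sum_{\ell=0}^\infty(2\ell+1)f_\ell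 P_\ell(\cos\theta),\qquad \tilde f(\cos\theta)=\sum_{\ell=0}^\infty(2\ell+1)\tilde f_\ell P_\ell(\cos\theta).$$ For $\ell\ge 0$ let $\xi_\ell$ be the normalized eigenstate of $\hat H$ of energy $E$ in partial wave $\ell$: a continuous function with $(E-\hat H)\xi_\ell=0$, of the form $\xi_\ell(x)=\rho_\ell(r)P_\ell(\cos\theta)$ for $x\neq0$, such that for some $s_\ell\in\mathbb C$, as $r\to\infty$, $$\xi_\ell(x)^*=\frac{2\ell+1}{r}P_\ell(\cos\theta)\,\frac{s_\ell e^{i|k|r}-(-1)^\ell e^{-i|k|r}}{2i|k|}+O(r^{-2})$$ (that is, the ingoing radial wave of $\xi_\ell^*$ is the one of the $\ell$-th partial wave of $e^{ik\cdot x}$). Then for every $\ell\ge0$ $$|f_\ell-\tilde f_\ell|\le\frac{M}{2\pi(2\ell+1)}\,\|\xi_\ell\|_\infty\,\|(E-\hat H)\tilde\psi\|_1,$$ where $\|\xi_\ell\|_\infty=\sup_x|\xi_\ell(x)|$, $\|\cdot\|_1$ is the $L_1(\mathbb R^3)$ norm, and the right-hand side is $+\infty$ when $(E-\hat H)\tilde\psi$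 is not integrable. -/

import Mathlib

open MeasureTheory Filter Topology Asymptotics
open scoped ENNReal ContDiff Nat ComplexConjugate

noncomputable section

namespace Scattering

/-- Physical space `ℝ³` with its Euclidean norm. -/
abbrev Space : Type := EuclideanSpace ℝ (Fin 3)

/-- A central potential of short range: `x ↦ V |x|` is locally integrable on `ℝ³` (so singular
potentials such as Yukawa's are allowed) and `V r = O(exp (-r / R))` as `r → ∞` for some `R > 0`. -/
structure IsShortRange (V : ℝ → ℝ) : Prop where
  locallyIntegrable : LocallyIntegrable (fun x : Space => V ‖x‖) volume
  decay : ∃ R : ℝ, 0 < R ∧ V =O[atTop] fun r : ℝ => Real.exp (-r / R)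

/-- The energy `k² / (2M)` of a particle of mass `M` with momentum `k`. -/
def energy (M : ℝ) (k : Space) : ℝ := ‖k‖ ^ 2 / (2 * M)

/-- `((E - H) g) x` for smooth `g`, where `H = -∇² / (2M) + V |x|`. -/
def energySubHamiltonian (M : ℝ) (V : ℝ → ℝ) (E : ℝ) (g : Space → ℂ) (x : Space) : ℂ :=
  (E : ℂ) * g x + (1 / (2 * M) : ℂ) * (Laplacian.laplacian g : Space → ℂ) x - (V ‖x‖ : ℂ) * g x

/-- `(E - H) ψ = h` in the sense of distributions on `ℝ³`, where `h` is a locally integrable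
function, the Schrödinger violation of `ψ`.  (`E - H` is its own formal transpose.) -/
def HasSchrodingerViolation (M : ℝ) (V : ℝ → ℝ) (E : ℝ) (ψ h : Space → ℂ) : Prop :=
  LocallyIntegrable h volume ∧
    ∀ g : Space → ℂ, ContDiff ℝ ∞ g → HasCompactSupport g →
      ∫ x, ψ x * energySubHamiltonian M V E g x = ∫ x, h x * g x

/-- `ψ` is a (continuous, not necessarily square-integrable) eigenstate of `H` with eigenvalue `E`:
`(E - H) ψ = 0` in the sense of distributions. -/
def IsEigenstate (M : ℝ) (V : ℝ → ℝ) (E : ℝ) (ψ : Space → ℂ) : Prop :=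
  Continuous ψ ∧ HasSchrodingerViolation M V E ψ 0

/-- `cos θ`, where `θ` is the angle between `k` and `x`. -/
def cosAngle (k x : Space) : ℝ := inner ℝ k x / (‖k‖ * ‖x‖)

/-- The plane wave `exp (i k·x)`. -/
def planeWave (k x : Space) : ℂ := Complex.exp (Complex.I * (inner ℝ k x : ℝ))

/-- `ψ` is a continuous wave function with ingoing plane wave `exp (i k·x)` and outgoing amplitude
`f`, a function of `cos θ ∈ [-1, 1]`:
`ψ x = exp (i k·x) + exp (i |k| r) / r * f (cos θ) + O(r⁻²)` as `r = |x| → ∞`. -/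
structure IsApproxScatteringState (k : Space) (f : ℝ → ℂ) (ψ : Space → ℂ) : Prop where
  continuous : Continuous ψ
  asymptotics :
    (fun x : Space => ψ x - planeWave k x
        - Complex.exp (Complex.I * ‖k‖ * ‖x‖) / ‖x‖ * f (cosAngle k x))
      =O[Bornology.cobounded Space] fun x : Space => (‖x‖ ^ 2)⁻¹

/-- An exact scattering state: one which is moreover an eigenstate of `H`, of energy `k² / (2M)`. -/
def IsScatteringState (M : ℝ) (V : ℝ → ℝ) (k : Space) (f : ℝ → ℂ) (ψ : Space → ℂ) : Prop :=
  IsApproxScatteringState k f ψ ∧ IsEigenstate M V (energy M k) ψ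

/-- The Legendre polynomial `P_ℓ`, by Rodrigues' formula. -/
def legendre (l : ℕ) : Polynomial ℝ :=
  Polynomial.C ((2 ^ l * (l ! : ℝ))⁻¹) *
    Polynomial.derivative^[l] ((Polynomial.X ^ 2 - 1) ^ l)

/-- `f u = ∑_ℓ (2ℓ + 1) a_ℓ P_ℓ(u)` on `[-1, 1]`, the series converging in mean square
(that is, `f (cos θ)` is the sum of the series in `L²` of the unit sphere). -/
def IsPartialWaveExpansion (f : ℝ → ℂ) (a : ℕ → ℂ) : Prop :=
  Tendsto
    (fun N : ℕ => eLpNorm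
      (fun u : ℝ => f u - ∑ l ∈ Finset.range N,
        (2 * (l : ℂ) + 1) * a l * (((legendre l).eval u : ℝ) : ℂ))
      2 (volume.restrict (Set.Icc (-1 : ℝ) 1)))
    atTop (𝓝 0)

/-- `ξ` is (up to conjugation, `ξ*` being the `ℓ`-th partial wave of a scattering state) the
eigenstate of `H` of energy `k² / (2M)` in partial wave `ℓ` with respect to the axis `k`, normalized
so that the ingoing radial wave of `ξ*` is that of the `ℓ`-th partial wave of `exp (i k·x)`:
`ξ* = (2ℓ + 1) / r * P_ℓ(cos θ) * (s * e^{i|k|r} - (-1)^ℓ e^{-i|k|r}) / (2i|k|) + O(r⁻²)`. -/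
structure IsPartialWaveEigenstate (M : ℝ) (V : ℝ → ℝ) (k : Space) (l : ℕ) (ξ : Space → ℂ) :
    Prop where
  eigenstate : IsEigenstate M V (energy M k) ξ
  partialWave : ∃ R : ℝ → ℂ, ∀ x : Space, x ≠ 0 →
    ξ x = R ‖x‖ * (((legendre l).eval (cosAngle k x) : ℝ) : ℂ)
  normalization : ∃ s : ℂ,
    (fun x : Space => conj (ξ x)
        - (2 * (l : ℂ) + 1) / ‖x‖ * (((legendre l).eval (cosAngle k x) : ℝ) : ℂ)
          * ((s * Complex.exp (Complex.I * ‖k‖ * ‖x‖)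
              - (-1) ^ l * Complex.exp (-(Complex.I * ‖k‖ * ‖x‖))) / (2 * Complex.I * ‖k‖)))
      =O[Bornology.cobounded Space] fun x : Space => (‖x‖ ^ 2)⁻¹

end Scattering

end

noncomputable section

namespace Scattering

/-! The proof is a Wronskian argument for the radial equation. For a continuous `g` let `proj n l g
r` be the integral of `g` against `P_l(cos θ)` over directions at radius `r`. Testing `(E - H) g =
h` against `v(r) / r * P_l(cos θ)` shows that `u = r * proj g` solves `u'' = W u + 2M r proj h`
weakly on `(0, ∞)`, with `W = l(l+1)/r² + 2MV - 2ME` (`exists_radial_equation`). As `V` is only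
locally integrable, `u'` is merely absolutely continuous, so derivatives are encoded by `IsPrim`.

Let `a` come from `ξ*`, which solves the same equation as `ξ` because `V` is real, and `p` from `ψ'
- ψ`. Then `a p' - p a'` is a primitive of `a H`, where `H = 2M r proj h`. At the origin it tends to
zero: continuity of the states gives `a, p = O(r)`, and integrability of `r² W` and `r H` gives `r
a', r p' → 0` (`tendsto_mul_deriv_zero`). At infinity the plane waves of `ψ'` and `ψ` cancel, so `p`
is asymptotic to `c e^{i|k|r}` with `c = 4π (a'_l - a_l)`. Since `W → -|k|²`, the asymptotics may be
differentiated (`tendsto_deriv_sub_waves`). Outgoing terms cancel in the Wronskian, and only the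
ingoing wave of `ξ*`, fixed by the normalization, survives: the limit has modulus `16π² |a_l -
a'_l|`.

Hence `16π² |a_l - a'_l| ≤ ∫ |a H|` (`wronskian_bound`). On each sphere `ξ = R(r) P_l`, so `proj ξ =
4π/(2l+1) * R`, while `R * proj h` is the integral of `ξ h` over directions. This bounds `∫ |a H|`
by `2M * 4π/(2l+1) * ‖ξ‖_∞ ‖h‖_1` (`lintegral_partialWave_le`), and dividing by `16π²` gives the
constant. -/

/-! ### Indefinite integrals and test functions on the half-line. -/

/-- On `(0, ∞)` the function `u` is an indefinite integral of the locally integrable `u'`. -/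
def IsPrim (u u' : ℝ → ℂ) : Prop :=
  ∀ a b : ℝ, 0 < a → 0 < b → IntervalIntegrable u' volume a b ∧ ∫ x in a..b, u' x = u b - u a

/-- Smooth real functions with compact support in `(0, ∞)`. -/
structure IsTest (v : ℝ → ℝ) : Prop where
  contDiff : ContDiff ℝ ∞ v
  compact : HasCompactSupport v
  pos : tsupport v ⊆ Set.Ioi 0

lemma IsPrim.sub {u u' w w' : ℝ → ℂ} (hu : IsPrim u u') (hw : IsPrim w w') :
    IsPrim (fun x => u x - w x) (fun x => u' x - w' x) := by
  intro a b ha hb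
  obtain ⟨h1, h2⟩ := hu a b ha hb
  obtain ⟨h3, h4⟩ := hw a b ha hb
  refine ⟨h1.sub h3, ?_⟩
  rw [intervalIntegral.integral_sub h1 h3, h2, h4]
  ring

lemma IsPrim.conj {u u' : ℝ → ℂ} (hu : IsPrim u u') :
    IsPrim (fun x => conj (u x)) (fun x => conj (u' x)) := by
  intro a b ha hb
  obtain ⟨h1, h2⟩ := hu a b ha hb
  refine ⟨⟨?_, ?_⟩, ?_⟩
  · exact (Complex.conjCLE.toContinuousLinearMap.integrable_comp h1.1)
  · exact (Complex.conjCLE.toContinuousLinearMap.integrable_comp h1.2)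
  · have := Complex.conjCLE.toContinuousLinearMap.intervalIntegral_comp_comm h1
    simp only [ContinuousLinearEquiv.coe_coe, Complex.conjCLE_apply] at this
    rw [this, h2, map_sub]

lemma IsPrim.congr' {u u' w' : ℝ → ℂ} (hu : IsPrim u u') (h : ∀ x, 0 < x → u' x = w' x) :
    IsPrim u w' := by
  intro a b ha hb
  obtain ⟨h1, h2⟩ := hu a b ha hb
  have key : Set.EqOn u' w' (Set.uIoc a b) := fun x hx =>
    h x (lt_trans (lt_min ha hb) hx.1)
  refine ⟨h1.congr key, ?_⟩
  rw [← h2]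
  refine intervalIntegral.integral_congr_ae (ae_of_all _ fun x hx => (key hx).symm)

lemma isPrim_of_hasDerivAt {u u' : ℝ → ℂ} (h : ∀ x, 0 < x → HasDerivAt u (u' x) x)
    (hc : ContinuousOn u' (Set.Ioi 0)) : IsPrim u u' := by
  intro a b ha hb
  have hsub : Set.uIcc a b ⊆ Set.Ioi 0 := fun x hx => lt_of_lt_of_le (lt_min ha hb) hx.1
  have hi : IntervalIntegrable u' volume a b := (hc.mono hsub).intervalIntegrable
  exact ⟨hi, intervalIntegral.integral_eq_sub_of_hasDerivAt (fun x hx => h x (hsub hx)) hi⟩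

lemma locallyIntegrableOn_intervalIntegrable {f : ℝ → ℂ}
    (hf : LocallyIntegrableOn f (Set.Ioi 0)) {a b : ℝ} (ha : 0 < a) (hb : 0 < b) :
    IntervalIntegrable f volume a b := by
  have hsub : Set.uIcc a b ⊆ Set.Ioi 0 := fun x hx => lt_of_lt_of_le (lt_min ha hb) hx.1
  rw [intervalIntegrable_iff]
  exact (hf.integrableOn_compact_subset hsub isCompact_uIcc).mono_set Set.uIoc_subset_uIcc

lemma isPrim_integral {f : ℝ → ℂ} (hf : LocallyIntegrableOn f (Set.Ioi 0)) (c : ℂ) :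
    IsPrim (fun x => c + ∫ t in (1 : ℝ)..x, f t) f := by
  intro a b ha hb
  have h := fun {a b : ℝ} => @locallyIntegrableOn_intervalIntegrable f hf a b
  refine ⟨h ha hb, ?_⟩
  rw [add_sub_add_left_eq_sub,
    intervalIntegral.integral_interval_sub_left (h one_pos hb) (h one_pos ha)]

lemma absolutelyContinuousOnInterval_congr {f g : ℝ → ℂ} {a b : ℝ}
    (hf : AbsolutelyContinuousOnInterval f a b) (h : Set.EqOn f g (Set.uIcc a b)) :
    AbsolutelyContinuousOnInterval g a b := by
  rw [absolutelyContinuousOnInterval_iff] at hf ⊢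
  intro ε hε
  obtain ⟨δ, hδ, H⟩ := hf ε hε
  refine ⟨δ, hδ, fun E hE hlt => ?_⟩
  convert H E hE hlt using 2 with i hi
  rw [h (hE.1 i hi).1, h (hE.1 i hi).2]

lemma absolutelyContinuousOnInterval_integral {f : ℝ → ℂ} {a b : ℝ}
    (h : IntervalIntegrable f volume a b) :
    AbsolutelyContinuousOnInterval (fun x => ∫ t in a..x, f t) a b := by
  have hre : IntervalIntegrable (fun x => (f x).re) volume a b := ⟨h.1.re, h.2.re⟩
  have him : IntervalIntegrable (fun x => (f x).im) volume a b := ⟨h.1.im, h.2.im⟩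
  have hcst : ∀ z : ℂ, AbsolutelyContinuousOnInterval (fun _ : ℝ => z) a b := fun z =>
    (LipschitzWith.const z).lipschitzOnWith.absolutelyContinuousOnInterval
  -- The real and imaginary parts are treated separately and recombined as `re • 1 + im • I`.
  have h1 := (hre.absolutelyContinuousOnInterval_intervalIntegral (c := a) (by simp)).smul
    (hcst 1)
  have h2 := (him.absolutelyContinuousOnInterval_intervalIntegral (c := a) (by simp)).smul
    (hcst Complex.I)
  refine absolutelyContinuousOnInterval_congr (h1.add h2) fun x hx => ?_
  have hi : IntervalIntegrable f volume a x :=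
    h.mono_set (Set.uIcc_subset_uIcc Set.left_mem_uIcc hx)
  have e1 := Complex.reCLM.intervalIntegral_comp_comm hi
  have e2 := Complex.imCLM.intervalIntegral_comp_comm hi
  simp only [Complex.reCLM_apply, Complex.imCLM_apply] at e1 e2
  simp only [Pi.add_apply, Pi.smul_apply', e1, e2]
  apply Complex.ext <;> simp

lemma IsPrim.absolutelyContinuousOnInterval {u u' : ℝ → ℂ} (hu : IsPrim u u') {a b : ℝ}
    (ha : 0 < a) (hb : 0 < b) : AbsolutelyContinuousOnInterval u a b := by
  have hcst : AbsolutelyContinuousOnInterval (fun _ : ℝ => u a) a b :=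
    (LipschitzWith.const (u a)).lipschitzOnWith.absolutelyContinuousOnInterval
  refine absolutelyContinuousOnInterval_congr
    ((absolutelyContinuousOnInterval_integral (hu a b ha hb).1).add hcst) fun x hx => ?_
  have hx0 : 0 < x := lt_of_lt_of_le (lt_min ha hb) hx.1
  simp only [Pi.add_apply, (hu a x ha hx0).2]
  ring

lemma IsPrim.continuousOn {u u' : ℝ → ℂ} (hu : IsPrim u u') : ContinuousOn u (Set.Ioi 0) := by
  intro x hx
  have hx' : (0 : ℝ) < x := hx
  have hc := (hu.absolutelyContinuousOnInterval (a := x / 2) (b := x + 1)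
    (by positivity) (by positivity)).continuousOn
  have hmem : Set.uIcc (x / 2) (x + 1) ∈ 𝓝 x := by
    rw [Set.uIcc_of_le (by linarith)]
    exact Icc_mem_nhds (by linarith) (by linarith)
  exact (hc.continuousAt hmem).continuousWithinAt

lemma IsPrim.ae_hasDerivAt {u u' : ℝ → ℂ} (hu : IsPrim u u') {a b : ℝ} (ha : 0 < a)
    (hb : 0 < b) : ∀ᵐ x, x ∈ Set.uIcc a b → HasDerivAt u (u' x) x := by
  filter_upwards [(hu a b ha hb).1.ae_hasDerivAt_integral] with x hx hxm
  have hx0 : 0 < x := lt_of_lt_of_le (lt_min ha hb) hxm.1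
  have h := (hx hxm a (by simp)).add_const (u a)
  refine h.congr_of_eventuallyEq ?_
  filter_upwards [lt_mem_nhds hx0] with y hy
  rw [(hu a y ha hy).2]
  ring

/-- Product rule for indefinite integrals. -/
lemma IsPrim.mul {u u' w w' : ℝ → ℂ} (hu : IsPrim u u') (hw : IsPrim w w') :
    IsPrim (fun x => u x * w x) (fun x => u' x * w x + u x * w' x) := by
  intro a b ha hb
  have hsub : Set.uIcc a b ⊆ Set.Ioi 0 := fun x hx => lt_of_lt_of_le (lt_min ha hb) hx.1
  have hi : IntervalIntegrable (fun x => u' x * w x + u x * w' x) volume a b :=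
    ((hu a b ha hb).1.mul_continuousOn (hw.continuousOn.mono hsub)).add
      ((hw a b ha hb).1.continuousOn_mul (hu.continuousOn.mono hsub))
  refine ⟨hi, ?_⟩
  have hac := absolutelyContinuousOnInterval_integral hi
  have hmul : AbsolutelyContinuousOnInterval (fun x => u x * w x) a b :=
    (hu.absolutelyContinuousOnInterval ha hb).smul (hw.absolutelyContinuousOnInterval ha hb)
  -- The product minus the integral of its expected derivative is absolutely continuous with
  -- derivative zero almost everywhere, hence constant.
  obtain ⟨C, hC⟩ := (hmul.sub hac).const_of_ae_hasDerivAt_zero (by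
    filter_upwards [hi.ae_hasDerivAt_integral, hu.ae_hasDerivAt ha hb, hw.ae_hasDerivAt ha hb]
      with x h1 h2 h3 hx
    have := ((h2 hx).mul (h3 hx)).sub (h1 hx a (by simp))
    rwa [sub_self] at this)
  have h1 := hC a (by simp)
  have h2 := hC b (by simp)
  simp only [Pi.sub_apply, intervalIntegral.integral_same, sub_zero] at h1 h2
  simp only [h1, ← h2]
  ring

lemma IsTest.derivative {v : ℝ → ℝ} (hv : IsTest v) : IsTest (deriv v) :=
  ⟨(contDiff_infty_iff_deriv.1 hv.contDiff).2, hv.compact.deriv,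
    (closure_mono (support_deriv_subset.trans subset_rfl)).trans
      ((isClosed_tsupport v).closure_subset.trans hv.pos)⟩

lemma IsTest.sub {v w : ℝ → ℝ} (hv : IsTest v) (hw : IsTest w) (c : ℝ) :
    IsTest (fun x => v x - c * w x) := by
  refine ⟨hv.contDiff.sub (contDiff_const.mul hw.contDiff), hv.compact.sub hw.compact.mul_left, ?_⟩
  have h : Function.support (fun x => v x - c * w x) ⊆ tsupport v ∪ tsupport w := by
    intro x hx
    by_contra hn
    simp only [Set.mem_union, not_or] at hn
    exact hx (by simp [image_eq_zero_of_notMem_tsupport hn.1,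
      image_eq_zero_of_notMem_tsupport hn.2])
  exact (closure_minimal h ((isClosed_tsupport v).union (isClosed_tsupport w))).trans
    (Set.union_subset hv.pos hw.pos)

/-- The interval containing the support is open, so `v` vanishes at `a` and `b` and integration by
parts over `[a, b]` has no boundary terms. -/
lemma IsTest.exists_Icc {v : ℝ → ℝ} (hv : IsTest v) :
    ∃ a b : ℝ, 0 < a ∧ a ≤ b ∧ tsupport v ⊆ Set.Ioo a b := by
  obtain ⟨b, hb⟩ := hv.compact.isCompact.bddAbove
  by_cases hne : (tsupport v).Nonempty
  · have ha := hv.compact.isCompact.sInf_mem hne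
    have ha0 : 0 < sInf (tsupport v) := hv.pos ha
    refine ⟨sInf (tsupport v) / 2, b + 1, by positivity, ?_, fun x hx => ⟨?_, ?_⟩⟩
    · linarith [hb ha]
    · linarith [csInf_le hv.compact.isCompact.bddBelow hx]
    · linarith [hb hx]
  · exact ⟨1, 1, one_pos, le_rfl, by simp [Set.not_nonempty_iff_eq_empty.1 hne]⟩

lemma setIntegral_Ioi_eq {f : ℝ → ℂ} {a b : ℝ} (ha : 0 < a) (hab : a ≤ b)
    (h : ∀ x, x ∉ Set.Ioo a b → f x = 0) : ∫ x in Set.Ioi (0 : ℝ), f x = ∫ x in a..b, f x := by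
  rw [intervalIntegral.integral_of_le hab]
  refine (setIntegral_eq_of_subset_of_forall_sdiff_eq_zero measurableSet_Ioi
    (fun x hx => ha.trans hx.1) fun x hx => h x fun hx' => hx.2 ⟨hx'.1, hx'.2.le⟩)

lemma IsTest.isPrim {v : ℝ → ℝ} (hv : IsTest v) :
    IsPrim (fun x => (v x : ℂ)) (fun x => ((deriv v x : ℝ) : ℂ)) :=
  isPrim_of_hasDerivAt (fun x _ => ((hv.contDiff.differentiable (by simp)) x).hasDerivAt.ofReal_comp)
    (Complex.continuous_ofReal.comp hv.derivative.contDiff.continuous).continuousOn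

lemma IsTest.locallyIntegrable_mul {v : ℝ → ℝ} (hv : IsTest v) {f : ℝ → ℂ}
    (hf : LocallyIntegrableOn f (Set.Ioi 0)) :
    IntegrableOn (fun x => (v x : ℂ) * f x) (Set.Ioi 0) := by
  obtain ⟨a, b, ha, hab, hs⟩ := hv.exists_Icc
  have h1 : IntegrableOn f (Set.Icc a b) :=
    hf.integrableOn_compact_subset (fun x hx => ha.trans_le hx.1) isCompact_Icc
  have h2 : IntegrableOn (fun x => (v x : ℂ) * f x) (Set.Icc a b) :=
    h1.continuousOn_mul (Complex.continuous_ofReal.comp hv.contDiff.continuous).continuousOn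
      isCompact_Icc
  refine h2.of_forall_sdiff_eq_zero measurableSet_Ioi fun x hx => ?_
  have : x ∉ tsupport v := fun h => hx.2 (Set.Ioo_subset_Icc_self (hs h))
  simp [image_eq_zero_of_notMem_tsupport this]

/-- Integration by parts against a test function. -/
lemma IsPrim.integral_deriv_test {u u' : ℝ → ℂ} (hu : IsPrim u u') {v : ℝ → ℝ} (hv : IsTest v) :
    ∫ x in Set.Ioi (0 : ℝ), ((deriv v x : ℝ) : ℂ) * u x
      = -∫ x in Set.Ioi (0 : ℝ), (v x : ℂ) * u' x := by
  obtain ⟨a, b, ha, hab, hs⟩ := hv.exists_Icc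
  have hb := ha.trans_le hab
  have hz : ∀ x, x ∉ Set.Ioo a b → v x = 0 := fun x hx =>
    image_eq_zero_of_notMem_tsupport fun h => hx (hs h)
  have hz' : ∀ x, x ∉ Set.Ioo a b → deriv v x = 0 := fun x hx => by
    by_contra h
    exact hx (hs (support_deriv_subset h))
  have hsub : Set.uIcc a b ⊆ Set.Ioi 0 := fun x hx => lt_of_lt_of_le (lt_min ha hb) hx.1
  rw [setIntegral_Ioi_eq ha hab fun x hx => by simp [hz' x hx],
    setIntegral_Ioi_eq ha hab fun x hx => by simp [hz x hx]]
  have h := (hv.isPrim.mul hu a b ha hb).2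
  simp only [hz a (by simp), hz b (by simp)] at h
  rw [intervalIntegral.integral_add] at h
  · rw [Complex.ofReal_zero, zero_mul, zero_mul, sub_zero] at h
    linear_combination h
  · exact (hv.isPrim a b ha hb).1.mul_continuousOn (hu.continuousOn.mono hsub)
  · exact (hu a b ha hb).1.continuousOn_mul (hv.isPrim.continuousOn.mono hsub)

/-! ### From weak to strong solutions: the du Bois-Reymond lemma. -/

/-- A test function of integral zero is the derivative of a test function. -/
lemma IsTest.exists_primitive {w : ℝ → ℝ} (hw : IsTest w) (h0 : ∫ x, w x = 0) :
    ∃ v, IsTest v ∧ deriv v = w := by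
  obtain ⟨a, b, ha, hab, hs⟩ := hw.exists_Icc
  have hz : ∀ x, x ∉ Set.Ioo a b → w x = 0 := fun x hx =>
    image_eq_zero_of_notMem_tsupport fun h => hx (hs h)
  have hc := hw.contDiff.continuous
  have hd : ∀ x, HasDerivAt (fun y => ∫ t in a..y, w t) (w x) x := fun x =>
    intervalIntegral.integral_hasDerivAt_right (hc.intervalIntegrable _ _)
      hc.stronglyMeasurable.stronglyMeasurableAtFilter hc.continuousAt
  have hd' : deriv (fun y => ∫ t in a..y, w t) = w := funext fun x => (hd x).deriv
  -- Vanishing of the total integral makes the primitive zero again to the right of `b`.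
  have hab0 : ∫ t in a..b, w t = 0 := by
    rw [intervalIntegral.integral_of_le hab, ← h0]
    exact setIntegral_eq_integral_of_forall_compl_eq_zero fun x hx =>
      hz x fun h => hx ⟨h.1, h.2.le⟩
  have hsupp : tsupport (fun y => ∫ t in a..y, w t) ⊆ Set.Icc a b := by
    refine closure_minimal (fun x hx => ?_) isClosed_Icc
    by_contra hn
    refine hx ?_
    rw [Set.mem_Icc, not_and_or, not_le, not_le] at hn
    simp only
    rcases hn with hn | hn
    · rw [intervalIntegral.integral_congr (g := fun _ => 0), intervalIntegral.integral_zero]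
      intro t ht
      rw [Set.uIcc_of_ge hn.le] at ht
      exact hz t fun h => absurd h.1 (not_lt.2 ht.2)
    · rw [← intervalIntegral.integral_add_adjacent_intervals (b := b)
        (hc.intervalIntegrable _ _) (hc.intervalIntegrable _ _), hab0, zero_add,
        intervalIntegral.integral_congr (g := fun _ => 0), intervalIntegral.integral_zero]
      intro t ht
      rw [Set.uIcc_of_le hn.le] at ht
      exact hz t fun h => absurd h.2 (not_lt.2 ht.1)
  refine ⟨_, ⟨?_, ?_, ?_⟩, hd'⟩
  · rw [contDiff_infty_iff_deriv, hd']
    exact ⟨fun x => (hd x).differentiableAt, hw.contDiff⟩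
  · exact isCompact_Icc.of_isClosed_subset (isClosed_tsupport _) hsupp
  · exact hsupp.trans fun x hx => ha.trans_le hx.1

lemma exists_isTest_integral_eq_one : ∃ θ : ℝ → ℝ, IsTest θ ∧ ∫ x, θ x = 1 := by
  -- The outer ball is `[1, 3]`, which lies inside `(0, ∞)`.
  let bump : ContDiffBump (2 : ℝ) := ⟨1 / 2, 1, by norm_num, by norm_num⟩
  refine ⟨bump.normed volume, ⟨bump.contDiff_normed, bump.hasCompactSupport_normed, ?_⟩,
    bump.integral_normed⟩
  rw [bump.tsupport_normed_eq]
  intro x hx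
  rw [Metric.mem_closedBall, Real.dist_eq] at hx
  have := (abs_le.1 hx).1
  simp only [bump] at this
  simp only [Set.mem_Ioi]
  linarith

lemma setIntegral_Ioi_test {w : ℝ → ℝ} (hw : IsTest w) :
    ∫ x in Set.Ioi (0 : ℝ), w x = ∫ x, w x :=
  setIntegral_eq_integral_of_forall_compl_eq_zero fun _ hx =>
    image_eq_zero_of_notMem_tsupport fun h => hx (hw.pos h)

lemma integral_test_const {w : ℝ → ℝ} (hw : IsTest w) (c : ℂ) :
    ∫ x in Set.Ioi (0 : ℝ), (w x : ℂ) * c = ((∫ x, w x : ℝ) : ℂ) * c := by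
  rw [integral_mul_const, integral_complex_ofReal, setIntegral_Ioi_test hw]

/-- du Bois-Reymond: a continuous function with weak derivative `B` is a primitive of `B`. -/
lemma isPrim_of_weak {A B : ℝ → ℂ} (hA : ContinuousOn A (Set.Ioi 0))
    (hB : LocallyIntegrableOn B (Set.Ioi 0))
    (h : ∀ w, IsTest w → ∫ x in Set.Ioi (0 : ℝ), ((deriv w x : ℝ) : ℂ) * A x
      = -∫ x in Set.Ioi (0 : ℝ), (w x : ℂ) * B x) : IsPrim A B := by
  have hB1 := isPrim_integral hB 0
  set B1 : ℝ → ℂ := fun x => 0 + ∫ t in (1 : ℝ)..x, B t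
  have hAl : LocallyIntegrableOn A (Set.Ioi 0) := hA.locallyIntegrableOn measurableSet_Ioi
  have hB1l := hB1.continuousOn.locallyIntegrableOn (μ := volume) measurableSet_Ioi
  obtain ⟨θ, hθ, hθ1⟩ := exists_isTest_integral_eq_one
  have hD : ∀ w, IsTest w → ∫ x in Set.Ioi (0 : ℝ), ((deriv w x : ℝ) : ℂ) * (A x - B1 x) = 0 := by
    intro w hw
    simp only [mul_sub]
    rw [integral_sub (hw.derivative.locallyIntegrable_mul hAl) (hw.derivative.locallyIntegrable_mul hB1l),
      h w hw, hB1.integral_deriv_test hw, sub_self]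
  -- If `A - B1` is constant, this is its value, since `θ` has integral one.
  set c : ℂ := ∫ x in Set.Ioi (0 : ℝ), (θ x : ℂ) * (A x - B1 x)
  have hDl : LocallyIntegrableOn (fun x => A x - B1 x) (Set.Ioi 0) := hAl.sub hB1l
  have hae := isOpen_Ioi.ae_eq_zero_of_integral_contDiff_smul_eq_zero
    (f := fun x => A x - B1 x - c) (μ := volume) (U := Set.Ioi (0 : ℝ))
    (hDl.sub (locallyIntegrableOn_const c)) (by
      intro w w1 w2 w3
      have hw : IsTest w := ⟨w1, w2, w3⟩
      -- `w - (∫ w) θ` has integral zero, so it is some `v'`. Testing `A - B1` against `v'` gives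
      -- zero, that is, `∫ w (A - B1) = c ∫ w`.
      obtain ⟨v, hv, hvw⟩ := (hw.sub hθ (∫ x, w x)).exists_primitive (by
        rw [integral_sub, integral_const_mul, hθ1, mul_one, sub_self]
        · exact hw.contDiff.continuous.integrable_of_hasCompactSupport hw.compact
        · exact (hθ.contDiff.continuous.integrable_of_hasCompactSupport hθ.compact).const_mul _)
      have h1 := hD v hv
      rw [hvw] at h1
      push_cast at h1
      have i1 := hw.locallyIntegrable_mul hDl
      have i2 := hθ.locallyIntegrable_mul hDl
      simp only [sub_mul, mul_assoc] at h1
      rw [integral_sub i1 (i2.const_mul _), integral_const_mul] at h1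
      rw [← setIntegral_eq_integral_of_forall_compl_eq_zero (s := Set.Ioi (0 : ℝ))]
      · simp only [Complex.real_smul, mul_sub _ _ c]
        rw [integral_sub i1, integral_test_const hw]
        · exact h1
        · exact hw.locallyIntegrable_mul (locallyIntegrableOn_const c)
      · intro x hx
        rw [image_eq_zero_of_notMem_tsupport fun h => hx (w3 h), zero_smul])
  have hEq : Set.EqOn (fun x => A x - B1 x) (fun _ => c) (Set.Ioi 0) := by
    refine Measure.eqOn_open_of_ae_eq (μ := volume) ?_ isOpen_Ioi (hA.sub hB1.continuousOn)
      continuousOn_const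
    rw [EventuallyEq, ae_restrict_iff' measurableSet_Ioi]
    filter_upwards [hae] with x hx hx0
    exact sub_eq_zero.1 (hx hx0)
  intro a b ha hb
  obtain ⟨h1, h2⟩ := hB1 a b ha hb
  refine ⟨h1, ?_⟩
  have e1 := hEq (Set.mem_Ioi.2 ha)
  have e2 := hEq (Set.mem_Ioi.2 hb)
  simp only at e1 e2
  rw [h2]
  linear_combination e1 - e2

/-- A continuous weak solution of `A'' = B` on `(0, ∞)` is twice an indefinite integral. -/
lemma exists_isPrim_of_weak {A B : ℝ → ℂ} (hA : ContinuousOn A (Set.Ioi 0))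
    (hB : LocallyIntegrableOn B (Set.Ioi 0))
    (h : ∀ w, IsTest w → ∫ x in Set.Ioi (0 : ℝ), ((deriv (deriv w) x : ℝ) : ℂ) * A x
      = ∫ x in Set.Ioi (0 : ℝ), (w x : ℂ) * B x) : ∃ A1, IsPrim A A1 ∧ IsPrim A1 B := by
  obtain ⟨θ, hθ, hθ1⟩ := exists_isTest_integral_eq_one
  have hB0 := isPrim_integral hB 0
  set B0 : ℝ → ℂ := fun x => 0 + ∫ t in (1 : ℝ)..x, B t
  have hAl : LocallyIntegrableOn A (Set.Ioi 0) := hA.locallyIntegrableOn measurableSet_Ioi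
  have hB0l := hB0.continuousOn.locallyIntegrableOn (μ := volume) measurableSet_Ioi
  -- The constant of integration in `A' = B0 + c`, forced by testing this equation against `θ`.
  set c : ℂ := -((∫ x in Set.Ioi (0 : ℝ), (θ x : ℂ) * B0 x)
    + ∫ x in Set.Ioi (0 : ℝ), ((deriv θ x : ℝ) : ℂ) * A x)
  have hB1 : IsPrim (fun x => B0 x + c) B := by
    intro a b ha hb
    obtain ⟨h1, h2⟩ := hB0 a b ha hb
    exact ⟨h1, by rw [h2]; ring⟩
  refine ⟨_, isPrim_of_weak hA
    (hB1.continuousOn.locallyIntegrableOn (μ := volume) measurableSet_Ioi) ?_, hB1⟩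
  intro w hw
  -- Writing `w = v' + (∫ w) θ`, the part `v'` is covered by the second-order equation tested with
  -- `v`, and the part `θ` by the choice of `c`.
  obtain ⟨v, hv, hvw⟩ := (hw.sub hθ (∫ x, w x)).exists_primitive (by
    rw [integral_sub, integral_const_mul, hθ1, mul_one, sub_self]
    · exact hw.contDiff.continuous.integrable_of_hasCompactSupport hw.compact
    · exact (hθ.contDiff.continuous.integrable_of_hasCompactSupport hθ.compact).const_mul _)
  have h1 := h v hv
  have h2 := hB0.integral_deriv_test hv
  have hdd : deriv (deriv v) = fun x => deriv w x - (∫ x, w x) * deriv θ x := by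
    rw [hvw]
    funext x
    have d1 := (hw.contDiff.differentiable (by simp)) x
    have d2 := (hθ.contDiff.differentiable (by simp)) x
    exact (d1.hasDerivAt.sub (d2.hasDerivAt.const_mul _)).deriv
  rw [hdd] at h1
  rw [hvw] at h2
  push_cast at h1 h2
  simp only [sub_mul, mul_assoc] at h1 h2
  rw [integral_sub (hw.derivative.locallyIntegrable_mul hAl)
    ((hθ.derivative.locallyIntegrable_mul hAl).const_mul _), integral_const_mul] at h1
  rw [integral_sub (hw.locallyIntegrable_mul hB0l)
    ((hθ.locallyIntegrable_mul hB0l).const_mul _), integral_const_mul] at h2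
  simp only [mul_add]
  rw [integral_add (hw.locallyIntegrable_mul hB0l)
    (hw.locallyIntegrable_mul (locallyIntegrableOn_const c)), integral_test_const hw]
  simp only [c]
  linear_combination h1 + h2

/-! ### First derivatives at infinity and at the origin. -/

/-- If `u → 0` and `∫_R^{R+1} |u''| → 0` as `R → ∞`, then `u' → 0`. -/
lemma tendsto_zero_of_isPrim {u u1 u2 : ℝ → ℂ} (h1 : IsPrim u u1) (h2 : IsPrim u1 u2)
    (hu : Tendsto u atTop (𝓝 0))
    (hu2 : Tendsto (fun R => ∫ x in R..R + 1, ‖u2 x‖) atTop (𝓝 0)) :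
    Tendsto u1 atTop (𝓝 0) := by
  have hsh : Tendsto (fun R : ℝ => u (R + 1)) atTop (𝓝 0) :=
    hu.comp (tendsto_atTop_add_const_right _ _ tendsto_id)
  have hb : Tendsto (fun R => ‖u (R + 1) - u R‖ + ∫ x in R..R + 1, ‖u2 x‖) atTop (𝓝 0) := by
    simpa using (hsh.sub hu).norm.add hu2
  refine squeeze_zero_norm' ?_ hb
  filter_upwards [eventually_gt_atTop 0] with R hR
  have hR1 : 0 < R + 1 := by positivity
  obtain ⟨i1, e1⟩ := h1 R (R + 1) hR hR1
  -- The mean of `u1` over `[R, R + 1]` is `u (R + 1) - u R`, and `u1` deviates from `u1 R` there by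
  -- at most the integral of `‖u2‖`.
  have key : u1 R = (u (R + 1) - u R) - ∫ x in R..R + 1, (u1 x - u1 R) := by
    rw [intervalIntegral.integral_sub i1 (by simp), e1]
    simp
  have hbd : ‖∫ x in R..R + 1, (u1 x - u1 R)‖ ≤ (∫ x in R..R + 1, ‖u2 x‖) * |R + 1 - R| := by
    refine intervalIntegral.norm_integral_le_of_norm_le_const fun x hx => ?_
    rw [Set.uIoc_of_le (by linarith)] at hx
    have hx0 : 0 < x := hR.trans hx.1
    rw [← (h2 R x hR hx0).2]
    refine (intervalIntegral.norm_integral_le_integral_norm hx.1.le).trans ?_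
    exact intervalIntegral.integral_mono_interval le_rfl hx.1.le hx.2
      (ae_of_all _ fun _ => norm_nonneg _) (h2 R (R + 1) hR hR1).1.norm
  rw [key]
  refine (norm_sub_le _ _).trans ?_
  gcongr
  simpa using hbd

/-- If `u = O(δ)` and `x u''` is integrable near zero, then `δ u' δ → 0` as `δ → 0`. -/
lemma tendsto_mul_zero_of_isPrim {u u1 u2 : ℝ → ℂ} (h1 : IsPrim u u1) (h2 : IsPrim u1 u2)
    (hu : Tendsto u (𝓝[>] 0) (𝓝 0)) (hu2 : IntegrableOn (fun x : ℝ => (x : ℂ) * u2 x) (Set.Ioc 0 1)) :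
    Tendsto (fun δ : ℝ => (δ : ℂ) * u1 δ) (𝓝[>] 0) (𝓝 0) := by
  have hsc : Tendsto (fun δ : ℝ => 2 * δ) (𝓝[>] 0) (𝓝[>] 0) := by
    refine tendsto_nhdsWithin_iff.2 ⟨?_, ?_⟩
    · have : Tendsto (fun δ : ℝ => 2 * δ) (𝓝 0) (𝓝 (2 * 0)) := tendsto_id.const_mul 2
      rw [mul_zero] at this
      exact this.mono_left nhdsWithin_le_nhds
    · filter_upwards [self_mem_nhdsWithin] with δ hδ
      simpa using hδ
  have hI : IntervalIntegrable (fun x : ℝ => ‖(x : ℂ) * u2 x‖) volume 0 1 :=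
    ((intervalIntegrable_iff_integrableOn_Ioc_of_le zero_le_one).2 hu2).norm
  have hprim : Tendsto (fun δ => ∫ x in (0 : ℝ)..δ, ‖(x : ℂ) * u2 x‖) (𝓝[>] 0) (𝓝 0) := by
    have hc := intervalIntegral.continuousOn_primitive_interval' hI (a := 0) (by simp)
    have h0 := hc 0 (by simp)
    rw [ContinuousWithinAt, intervalIntegral.integral_same] at h0
    refine h0.mono_left ?_
    rw [Set.uIcc_of_le zero_le_one]
    exact nhdsWithin_le_of_mem (mem_of_superset (Ioc_mem_nhdsGT one_pos) Set.Ioc_subset_Icc_self)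
  have hb : Tendsto (fun δ => ‖u (2 * δ) - u δ‖
      + ((∫ x in (0 : ℝ)..(2 * δ), ‖(x : ℂ) * u2 x‖))) (𝓝[>] 0) (𝓝 0) := by
    simpa using ((hu.comp hsc).sub hu).norm.add (hprim.comp hsc)
  refine squeeze_zero_norm' ?_ hb
  filter_upwards [Ioo_mem_nhdsGT (show (0 : ℝ) < 1 / 2 by norm_num)] with δ hδ
  have hδ0 : 0 < δ := hδ.1
  have h2δ : 0 < 2 * δ := by positivity
  obtain ⟨i1, e1⟩ := h1 δ (2 * δ) hδ0 h2δ
  have key : (δ : ℂ) * u1 δ = (u (2 * δ) - u δ) - ∫ x in δ..2 * δ, (u1 x - u1 δ) := by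
    rw [intervalIntegral.integral_sub i1 (by simp), e1, intervalIntegral.integral_const,
      Complex.real_smul]
    push_cast
    ring
  have hsub : ∀ c, δ ≤ c → c ≤ 2 * δ → IntervalIntegrable (fun x : ℝ => ‖(x : ℂ) * u2 x‖) volume
      δ c := fun c h3 h4 => hI.mono_set (by
    rw [Set.uIcc_of_le h3, Set.uIcc_of_le zero_le_one]
    exact Set.Icc_subset_Icc hδ0.le (by linarith [hδ.2]))
  -- The same mean value argument on `[δ, 2δ]`. There `‖u2 t‖ ≤ δ⁻¹ ‖t * u2 t‖`, and the factor
  -- `δ⁻¹` is absorbed by the length of the interval.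
  have hbd : ‖∫ x in δ..2 * δ, (u1 x - u1 δ)‖
      ≤ (δ⁻¹ * ∫ x in (0 : ℝ)..(2 * δ), ‖(x : ℂ) * u2 x‖) * |2 * δ - δ| := by
    refine intervalIntegral.norm_integral_le_of_norm_le_const fun x hx => ?_
    rw [Set.uIoc_of_le (by linarith)] at hx
    have hx0 : 0 < x := hδ0.trans hx.1
    rw [← (h2 δ x hδ0 hx0).2]
    refine (intervalIntegral.norm_integral_le_integral_norm hx.1.le).trans ?_
    calc ∫ t in δ..x, ‖u2 t‖ ≤ ∫ t in δ..x, δ⁻¹ * ‖(t : ℂ) * u2 t‖ := by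
          refine intervalIntegral.integral_mono_on hx.1.le (h2 δ x hδ0 hx0).1.norm
            ((hsub x hx.1.le hx.2).const_mul _) fun t ht => ?_
          rw [norm_mul, Complex.norm_real, Real.norm_of_nonneg (hδ0.le.trans ht.1), ← mul_assoc]
          refine le_mul_of_one_le_left (norm_nonneg _) ?_
          rw [← div_eq_inv_mul, one_le_div hδ0]
          exact ht.1
      _ = δ⁻¹ * ∫ t in δ..x, ‖(t : ℂ) * u2 t‖ := intervalIntegral.integral_const_mul _ _
      _ ≤ _ := by
          gcongr
          exact intervalIntegral.integral_mono_interval hδ0.le hx.1.le hx.2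
            (ae_of_all _ fun _ => norm_nonneg _) (hI.mono_set (by
              rw [Set.uIcc_of_le h2δ.le, Set.uIcc_of_le zero_le_one]
              exact Set.Icc_subset_Icc le_rfl (by linarith [hδ.2])))
  rw [key]
  refine (norm_sub_le _ _).trans ?_
  gcongr
  refine hbd.trans (le_of_eq ?_)
  rw [abs_of_pos (by linarith)]
  field_simp
  ring

/-! ### Legendre polynomials: differential equation, orthogonality, norm. -/

open Polynomial in
/-- Legendre's differential equation. -/
lemma legendre_ode (l : ℕ) (t : ℝ) :
    (1 - t ^ 2) * (derivative (derivative (legendre l))).eval t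
      - 2 * t * (derivative (legendre l)).eval t
      = -(l * (l + 1)) * (legendre l).eval t := by
  set w : ℝ[X] := (X ^ 2 - 1) ^ l with hw
  -- `w = (X² - 1)^l` satisfies `(X² - 1) w' = 2l X w`. Differentiating this `l + 1` times by
  -- Leibniz' rule gives Legendre's equation for the `l`-th derivative of `w`.
  have hrel : (derivative w) * X * X - derivative w = C (2 * (l : ℝ)) * (w * X) := by
    rcases l with _ | l
    · simp [hw]
    · have hd : derivative w = C ((l : ℝ) + 1) * (X ^ 2 - 1) ^ l * (C 2 * X) := by
        rw [hw, derivative_pow_succ]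
        simp [one_add_one_eq_two]
      rw [hd, hw]
      push_cast [C_mul]
      ring
  have h := congrArg (derivative^[l + 1]) hrel
  rw [iterate_derivative_sub, iterate_derivative_mul_X, iterate_derivative_C_mul,
    iterate_derivative_mul_X w, iterate_derivative_mul_X, iterate_derivative_mul_X,
    Nat.add_sub_cancel] at h
  have e1 : derivative^[l + 1] (derivative w) = derivative (derivative (derivative^[l] w)) := by
    rw [← Function.iterate_succ_apply, ← Function.iterate_succ_apply' derivative,
      ← Function.iterate_succ_apply' derivative]
  have e2 : derivative^[l + 1] w = derivative (derivative^[l] w) :=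
    Function.iterate_succ_apply' _ _ _
  -- The truncated subtraction at `l = 0` is harmless, because the coefficient `l` is then zero.
  have e3 : l • derivative^[l - 1] (derivative w) = l • derivative^[l] w := by
    rcases l with _ | l
    · simp
    · rw [Nat.add_sub_cancel, ← Function.iterate_succ_apply]
  have e4 : derivative^[l] (derivative w) = derivative (derivative^[l] w) :=
    (Function.iterate_succ_apply _ _ _).symm.trans e2
  rw [e3] at h
  simp only [e1, e2, e4] at h
  have h2 := congrArg (eval t) h
  simp only [eval_sub, eval_add, eval_mul, eval_X, eval_C, nsmul_eq_mul,
    eval_natCast] at h2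
  push_cast at h2
  simp only [legendre, derivative_C_mul, eval_mul, eval_C, ← hw]
  linear_combination -(2 ^ l * (l ! : ℝ))⁻¹ * h2

lemma integral_derivative_mul (p q : Polynomial ℝ) (h1 : (p * q).eval 1 = 0)
    (h2 : (p * q).eval (-1) = 0) :
    ∫ t in (-1 : ℝ)..1, (Polynomial.derivative p * q).eval t
      = -∫ t in (-1 : ℝ)..1, (p * Polynomial.derivative q).eval t := by
  have h := intervalIntegral.integral_eq_sub_of_hasDerivAt (a := -1) (b := 1)
    (fun t _ => (p * q).hasDerivAt t)
    ((Polynomial.derivative (p * q)).continuous.intervalIntegrable _ _)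
  rw [h1, h2, sub_zero, Polynomial.derivative_mul] at h
  simp only [Polynomial.eval_add] at h
  rw [intervalIntegral.integral_add ((Polynomial.continuous _).intervalIntegrable _ _)
    ((Polynomial.continuous _).intervalIntegrable _ _)] at h
  linarith

open Polynomial in
-- Repeated integration by parts: `±1` are zeros of order `l` of `(X² - 1)^l`, so no boundary term
-- appears during the first `l` steps.
lemma integral_rodrigues (l : ℕ) (q : ℝ[X]) (j : ℕ) (hj : j ≤ l) :
    ∫ t in (-1 : ℝ)..1, (derivative^[l] ((X ^ 2 - 1) ^ l) * q).eval t
      = (-1) ^ j * ∫ t in (-1 : ℝ)..1,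
        (derivative^[l - j] ((X ^ 2 - 1) ^ l) * derivative^[j] q).eval t := by
  induction j with
  | zero => simp
  | succ j ih =>
    rw [ih (by omega)]
    have e : l - j = (l - (j + 1)) + 1 := by omega
    have hz : ∀ t : ℝ, t ^ 2 = 1 →
        (derivative^[l - (j + 1)] ((X ^ 2 - 1 : ℝ[X]) ^ l) * derivative^[j] q).eval t = 0 := by
      intro t ht
      obtain ⟨r, hr⟩ := pow_sub_dvd_iterate_derivative_pow (X ^ 2 - 1 : ℝ[X]) l (l - (j + 1))
      have e2 : l - (l - (j + 1)) = j + 1 := by omega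
      rw [hr, e2]
      simp [ht]
    rw [e, Function.iterate_succ_apply', integral_derivative_mul _ _ (hz 1 (by norm_num))
      (hz (-1) (by norm_num)), ← Function.iterate_succ_apply' derivative j, pow_succ]
    ring

/-- All derivatives now fall on `q`: this gives zero when `deg q < l`, and reduces the norm of `P_l`
to its leading coefficient and `∫ (1 - t²)^l`. -/
lemma integral_legendre_mul (l : ℕ) (q : Polynomial ℝ) :
    ∫ t in (-1 : ℝ)..1, (legendre l).eval t * q.eval t
      = (2 ^ l * (l ! : ℝ))⁻¹ * ((-1) ^ l * ∫ t in (-1 : ℝ)..1,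
        (t ^ 2 - 1) ^ l * (Polynomial.derivative^[l] q).eval t) := by
  have h := integral_rodrigues l q l le_rfl
  simp only [Nat.sub_self, Function.iterate_zero, id_eq, Polynomial.eval_mul, Polynomial.eval_pow,
    Polynomial.eval_sub, Polynomial.eval_X, Polynomial.eval_one] at h
  rw [← h, ← intervalIntegral.integral_const_mul]
  simp only [legendre, Polynomial.eval_mul, Polynomial.eval_C, mul_assoc]

lemma natDegree_sq_sub_one_pow_le (l : ℕ) :
    ((Polynomial.X ^ 2 - 1 : Polynomial ℝ) ^ l).natDegree ≤ 2 * l := by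
  rw [mul_comm]
  refine Polynomial.natDegree_pow_le_of_le l ?_
  compute_degree

lemma natDegree_legendre_le (l : ℕ) : (legendre l).natDegree ≤ l := by
  refine (Polynomial.natDegree_C_mul_le _ _).trans
    ((Polynomial.natDegree_iterate_derivative _ _).trans ?_)
  have := natDegree_sq_sub_one_pow_le l
  omega

lemma integral_legendre_mul_of_lt {l m : ℕ} (h : m < l) :
    ∫ t in (-1 : ℝ)..1, (legendre l).eval t * (legendre m).eval t = 0 := by
  rw [integral_legendre_mul, Polynomial.iterate_derivative_eq_zero
    ((natDegree_legendre_le m).trans_lt h)]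
  simp

lemma integral_legendre_mul_of_ne {l m : ℕ} (h : m ≠ l) :
    ∫ t in (-1 : ℝ)..1, (legendre l).eval t * (legendre m).eval t = 0 := by
  rcases lt_or_gt_of_ne h with h | h
  · exact integral_legendre_mul_of_lt h
  · simp_rw [mul_comm ((legendre l).eval _)]
    exact integral_legendre_mul_of_lt h

lemma integral_one_sub_sq_pow (l : ℕ) :
    ∫ t in (-1 : ℝ)..1, (1 - t ^ 2) ^ l
      = 2 * (2 ^ l * (l ! : ℝ)) ^ 2 / ((2 * l + 1)! : ℝ) := by
  induction l with
  | zero => simp; norm_num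
  | succ l ih =>
    -- This function vanishes at `±1`, so integrating its derivative gives `(2l+3) I_{l+1} = (2l+2)
    -- I_l` for the integrals `I_l` in question.
    have hd : ∀ t : ℝ, HasDerivAt (fun t : ℝ => t * (1 - t ^ 2) ^ (l + 1))
        ((2 * l + 3) * (1 - t ^ 2) ^ (l + 1) - (2 * l + 2) * (1 - t ^ 2) ^ l) t := by
      intro t
      have h := (hasDerivAt_id t).mul ((((hasDerivAt_id t).pow 2).const_sub 1).pow (l + 1))
      refine h.congr_deriv ?_
      simp
      ring
    have h := intervalIntegral.integral_eq_sub_of_hasDerivAt (a := -1) (b := 1)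
      (fun t _ => hd t) (by apply Continuous.intervalIntegrable; fun_prop)
    rw [intervalIntegral.integral_sub (by apply Continuous.intervalIntegrable; fun_prop)
      (by apply Continuous.intervalIntegrable; fun_prop), intervalIntegral.integral_const_mul,
      intervalIntegral.integral_const_mul, ih] at h
    have e : 2 * (l + 1) + 1 = (2 * l + 1) + 1 + 1 := by ring
    rw [e, Nat.factorial_succ (2 * l + 1 + 1), Nat.factorial_succ (2 * l + 1),
      Nat.factorial_succ l]
    push_cast
    have h3 : (0 : ℝ) < 2 * l + 3 := by positivity
    have h4 : ((2 * l + 1)! : ℝ) ≠ 0 := by positivity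
    have h5 : (∫ t in (-1 : ℝ)..1, (1 - t ^ 2) ^ (l + 1))
        = (2 * l + 2) * (2 * (2 ^ l * (l ! : ℝ)) ^ 2 / ((2 * l + 1)! : ℝ)) / (2 * l + 3) := by
      rw [eq_div_iff h3.ne']
      norm_num at h
      linarith
    rw [h5]
    field_simp
    ring

/-- Together with the derivatives in Rodrigues' formula, `2l` derivatives fall on the monic
polynomial `(X² - 1)^l` of degree `2l`, leaving `(2l)!`. -/
lemma iterate_derivative_legendre (l : ℕ) :
    Polynomial.derivative^[l] (legendre l)
      = Polynomial.C ((2 ^ l * (l ! : ℝ))⁻¹ * ((2 * l)! : ℝ)) := by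
  have hdeg : (Polynomial.derivative^[l] (legendre l)).natDegree ≤ 0 := by
    refine (Polynomial.natDegree_iterate_derivative _ _).trans ?_
    have := natDegree_legendre_le l
    omega
  rw [Polynomial.eq_C_of_natDegree_le_zero hdeg]
  congr 1
  rw [legendre, Polynomial.iterate_derivative_C_mul, ← Function.iterate_add_apply,
    Polynomial.coeff_C_mul, Polynomial.coeff_iterate_derivative, zero_add, ← two_mul]
  have hmonic : (Polynomial.X ^ 2 - 1 : Polynomial ℝ).Monic :=
    Polynomial.monic_X_pow_sub_C 1 (by norm_num)
  have hd : (Polynomial.X ^ 2 - 1 : Polynomial ℝ).natDegree = 2 :=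
    Polynomial.natDegree_X_pow_sub_C (r := (1 : ℝ))
  have h1 := (hmonic.pow l).coeff_natDegree
  rw [hmonic.natDegree_pow, hd, mul_comm] at h1
  rw [h1, Nat.descFactorial_self]
  simp

lemma integral_legendre_sq (l : ℕ) :
    ∫ t in (-1 : ℝ)..1, (legendre l).eval t * (legendre l).eval t = 2 / (2 * l + 1) := by
  rw [integral_legendre_mul, iterate_derivative_legendre]
  simp only [Polynomial.eval_C]
  rw [intervalIntegral.integral_mul_const, ← mul_assoc ((-1 : ℝ) ^ l),
    ← intervalIntegral.integral_const_mul]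
  have h : ∀ t : ℝ, (-1) ^ l * (t ^ 2 - 1) ^ l = (1 - t ^ 2) ^ l := fun t => by
    rw [← mul_pow]
    ring
  simp only [h]
  rw [integral_one_sub_sq_pow, Nat.factorial_succ]
  push_cast
  field_simp

/-! ### Polar coordinates and integration over the unit sphere. -/

/-- The unit sphere of `Space`. -/
abbrev Sph : Type := Metric.sphere (0 : Space) 1

/-- The surface measure on the unit sphere. -/
def sphMeasure : Measure Sph := (volume : Measure Space).toSphere

instance : IsFiniteMeasure sphMeasure := by
  unfold sphMeasure
  infer_instance

/-- The measure `r² dr` on `(0, ∞)`. -/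
def radialMeasure : Measure ℝ :=
  (volume.restrict (Set.Ioi 0)).withDensity fun r => ENNReal.ofReal (r ^ 2)

instance : SFinite radialMeasure := by
  unfold radialMeasure
  infer_instance

lemma measurable_polar : Measurable fun p : Sph × ℝ => p.2 • (p.1 : Space) :=
  (continuous_snd.smul (continuous_subtype_val.comp continuous_fst)).measurable

/-- Polar coordinates in `ℝ³`. -/
lemma measurePreserving_polar :
    MeasurePreserving (fun p : Sph × ℝ => p.2 • (p.1 : Space))
      (sphMeasure.prod radialMeasure) volume := by
  have h1 := (volume : Measure Space).measurePreserving_homeomorphUnitSphereProd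
  rw [finrank_euclideanSpace_fin] at h1
  -- The radial exponent is the dimension minus one. The steps below carry this identification of
  -- `ℝ³ \ {0}` over to the ambient spaces, the origin being a null set.
  have h1' : MeasurePreserving (homeomorphUnitSphereProd Space).symm.toMeasurableEquiv
      (sphMeasure.prod (Measure.volumeIoiPow 2)) (Measure.comap Subtype.val volume) :=
    MeasurePreserving.symm (homeomorphUnitSphereProd Space).toMeasurableEquiv h1
  have h2 : MeasurePreserving (Subtype.val : ({(0 : Space)}ᶜ : Set Space) → Space)
      (Measure.comap Subtype.val volume) volume := by
    have := measurePreserving_subtype_coe (μa := (volume : Measure Space))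
      (measurableSet_singleton (0 : Space)).compl
    rwa [restrict_compl_singleton] at this
  have h3 : MeasurePreserving (Subtype.val : Set.Ioi (0 : ℝ) → ℝ) (Measure.volumeIoiPow 2)
      radialMeasure := by
    refine ⟨measurable_subtype_coe, ?_⟩
    have h := (measurePreserving_subtype_coe (μa := (volume : Measure ℝ))
      (measurableSet_Ioi (a := (0 : ℝ)))).map_eq
    unfold Measure.volumeIoiPow radialMeasure
    rw [← h]
    ext s hs
    rw [Measure.map_apply measurable_subtype_coe hs, withDensity_apply _ hs,
      withDensity_apply _ (measurable_subtype_coe hs), setLIntegral_map hs (by fun_prop)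
        measurable_subtype_coe]
  have h4 := (MeasurePreserving.id sphMeasure).prod h3
  refine ⟨measurable_polar, ?_⟩
  rw [← h4.map_eq, Measure.map_map measurable_polar h4.measurable, ← (h2.comp h1').map_eq]
  congr 1

lemma integral_radialMeasure (G : ℝ → ℂ) :
    ∫ r, G r ∂radialMeasure = ∫ r in Set.Ioi (0 : ℝ), (r : ℂ) ^ 2 * G r := by
  unfold radialMeasure
  rw [integral_withDensity_eq_integral_toReal_smul (by fun_prop) (by simp)]
  refine integral_congr_ae (ae_of_all _ fun r => ?_)
  simp [ENNReal.toReal_ofReal (sq_nonneg r)]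

lemma integrable_radialMeasure {G : ℝ → ℂ} (h : Integrable G radialMeasure) :
    IntegrableOn (fun r : ℝ => (r : ℂ) ^ 2 * G r) (Set.Ioi 0) := by
  unfold radialMeasure at h
  rw [integrable_withDensity_iff_integrable_smul' (by fun_prop) (by simp)] at h
  refine h.congr (ae_of_all _ fun r => ?_)
  simp [ENNReal.toReal_ofReal (sq_nonneg r)]

lemma integrableOn_polar {G : Space → ℂ} (hG : Integrable G) :
    IntegrableOn (fun r : ℝ => (r : ℂ) ^ 2 * ∫ z : Sph, G (r • (z : Space)) ∂sphMeasure)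
      (Set.Ioi 0) :=
  integrable_radialMeasure
    (measurePreserving_polar.integrable_comp_of_integrable hG).integral_prod_right

lemma integral_polar {G : Space → ℂ} (hG : Integrable G) :
    ∫ x, G x = ∫ r in Set.Ioi (0 : ℝ),
      (r : ℂ) ^ 2 * ∫ z : Sph, G (r • (z : Space)) ∂sphMeasure := by
  have h := measurePreserving_polar.integrable_comp_of_integrable hG
  rw [← integral_radialMeasure]
  refine Eq.trans ?_ (integral_prod_symm _ h)
  conv_lhs => rw [← measurePreserving_polar.map_eq]
  exact integral_map measurable_polar.aemeasurable
    (by rw [measurePreserving_polar.map_eq]; exact hG.aestronglyMeasurable)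

lemma lintegral_polar {G : Space → ℝ≥0∞} (hG : Measurable G) :
    ∫⁻ x, G x = ∫⁻ r in Set.Ioi (0 : ℝ),
      ENNReal.ofReal (r ^ 2) * ∫⁻ z : Sph, G (r • (z : Space)) ∂sphMeasure := by
  rw [← measurePreserving_polar.lintegral_comp hG]
  refine (lintegral_prod_symm _ (hG.comp measurable_polar).aemeasurable).trans ?_
  unfold radialMeasure
  rw [lintegral_withDensity_eq_lintegral_mul _ (by fun_prop)
    ((hG.comp measurable_polar).lintegral_prod_left')]
  rfl

lemma exists_basis {n : Space} (hn : ‖n‖ = 1) :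
    ∃ b : OrthonormalBasis (Fin 3) ℝ Space, b 0 = n := by
  obtain ⟨b, hb⟩ := Orthonormal.exists_orthonormalBasis_extension_of_card_eq (𝕜 := ℝ)
    (E := Space) (ι := Fin 3) (by simp) (v := fun _ => n) (s := {0}) (by
      constructor
      · intro i; simpa using hn
      · intro i j hij
        exact absurd (Subsingleton.elim i j) hij)
  exact ⟨b, hb 0 (by simp)⟩

/-- A Gaussian moment, computed in Cartesian coordinates. -/
lemma integral_inner_pow_mul_exp {n : Space} (hn : ‖n‖ = 1) (m : ℕ) :
    ∫ x : Space, (inner ℝ n x) ^ m * Real.exp (-‖x‖ ^ 2)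
      = Real.pi * ∫ t : ℝ, t ^ m * Real.exp (-t ^ 2) := by
  obtain ⟨b, hb⟩ := exists_basis hn
  rw [← b.measurePreserving_repr_symm.integral_comp
    b.repr.symm.toHomeomorph.measurableEmbedding,
    ← (PiLp.volume_preserving_toLp (Fin 3)).integral_comp
      (MeasurableEquiv.toLp 2 (Fin 3 → ℝ)).measurableEmbedding]
  have h : ∀ y : Fin 3 → ℝ, (inner ℝ n (b.repr.symm (WithLp.toLp 2 y))) ^ m
      * Real.exp (-‖b.repr.symm (WithLp.toLp 2 y)‖ ^ 2)
      = ∏ i, (if i = 0 then (y i) ^ m * Real.exp (-(y i) ^ 2) else Real.exp (-(y i) ^ 2)) := by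
    intro y
    rw [LinearIsometryEquiv.norm_map, ← hb, ← b.repr_apply_apply,
      LinearIsometryEquiv.apply_symm_apply, EuclideanSpace.norm_sq_eq]
    simp [Fin.prod_univ_three, Fin.sum_univ_three, Real.exp_add]
    ring
  simp only [h]
  rw [integral_fintype_prod_volume_eq_prod
    (fun (i : Fin 3) (t : ℝ) => if i = 0 then t ^ m * Real.exp (-t ^ 2) else Real.exp (-t ^ 2))]
  have hg : ∫ t : ℝ, Real.exp (-t ^ 2) = √Real.pi := by
    simpa using integral_gaussian 1
  simp only [Fin.prod_univ_three]
  simp only [if_true, Fin.isValue, one_ne_zero, if_false, Fin.reduceEq, hg]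
  rw [mul_assoc, Real.mul_self_sqrt Real.pi_pos.le, mul_comm]

lemma integral_Ioi_pow_mul_exp (m : ℕ) :
    ∫ t in Set.Ioi (0 : ℝ), t ^ m * Real.exp (-t ^ 2) = 1 / 2 * Real.Gamma ((m + 1) / 2) := by
  have h := integral_rpow_mul_exp_neg_rpow (p := 2) (q := m) two_pos
    (by have : (0 : ℝ) ≤ m := m.cast_nonneg
        linarith)
  simpa [Real.rpow_natCast] using h

lemma integrable_pow_mul_exp (m : ℕ) :
    Integrable fun t : ℝ => t ^ m * Real.exp (-t ^ 2) := by
  have h := integrable_rpow_mul_exp_neg_mul_sq one_pos (s := m)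
    (by have : (0 : ℝ) ≤ m := m.cast_nonneg
        linarith)
  simpa [Real.rpow_natCast] using h

lemma integral_pow_mul_exp (m : ℕ) :
    ∫ t : ℝ, t ^ m * Real.exp (-t ^ 2)
      = (1 + (-1) ^ m) * ∫ t in Set.Ioi (0 : ℝ), t ^ m * Real.exp (-t ^ 2) := by
  have hneg : ∀ t : ℝ, (-t) ^ m * Real.exp (-(-t) ^ 2)
      = (-1) ^ m * (t ^ m * Real.exp (-t ^ 2)) := fun t => by
    rw [neg_pow t m, neg_sq]
    ring
  have h1 := integrable_pow_mul_exp m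
  rw [← intervalIntegral.integral_Iic_add_Ioi h1.integrableOn h1.integrableOn]
  have h3 := integral_comp_neg_Ioi (0 : ℝ) (fun t : ℝ => t ^ m * Real.exp (-t ^ 2))
  simp only [hneg, neg_zero] at h3
  rw [← h3, integral_const_mul]
  ring

/-- The Gaussian moment of `⟪n, x⟫ ^ m` is computed in polar and in Cartesian coordinates. The
radial factor is `Γ((m+3)/2) / 2`, the Cartesian one involves `Γ((m+1)/2) / 2`, and the functional
equation of `Γ` leaves the factor `(m+1)/2`. -/
lemma integral_sphere_inner_pow {n : Space} (hn : ‖n‖ = 1) (m : ℕ) :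
    ∫ z : Sph, (inner ℝ n (z : Space)) ^ m ∂sphMeasure
      = 2 * Real.pi * ∫ t in (-1 : ℝ)..1, t ^ m := by
  have hint : Integrable fun x : Space =>
      (((inner ℝ n x) ^ m * Real.exp (-‖x‖ ^ 2) : ℝ) : ℂ) := by
    have h1 : Integrable (fun x : Space => ‖x‖ ^ m * Real.exp (-‖x‖ ^ 2)) := by
      rw [integrable_fun_norm_addHaar volume (f := fun r : ℝ => r ^ m * Real.exp (-r ^ 2))]
      refine (integrable_pow_mul_exp (m + 2)).integrableOn.congr (ae_of_all _ fun r => ?_)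
      simp
      ring
    have h2 : Continuous fun x : Space => (inner ℝ n x) ^ m * Real.exp (-‖x‖ ^ 2) := by fun_prop
    refine (h1.mono' h2.aestronglyMeasurable (ae_of_all _ fun x => ?_)).ofReal
    rw [norm_mul, norm_pow, Real.norm_of_nonneg (Real.exp_pos _).le]
    gcongr
    simpa [hn] using norm_inner_le_norm (𝕜 := ℝ) n x
  have h := integral_polar hint
  rw [integral_complex_ofReal, integral_inner_pow_mul_exp hn, integral_pow_mul_exp] at h
  have hr : ∀ r ∈ Set.Ioi (0 : ℝ), (r : ℂ) ^ 2 * ∫ z : Sph, (((inner ℝ n (r • (z : Space))) ^ m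
      * Real.exp (-‖r • (z : Space)‖ ^ 2) : ℝ) : ℂ) ∂sphMeasure
      = ((r ^ (m + 2) * Real.exp (-r ^ 2) *
        ∫ z : Sph, (inner ℝ n (z : Space)) ^ m ∂sphMeasure : ℝ) : ℂ) := by
    intro r hr
    have hz : ∀ z : Sph, ‖(z : Space)‖ = 1 := fun z => by simp
    simp only [inner_smul_right, norm_smul, hz, mul_one, mul_pow, Real.norm_eq_abs,
      sq_abs]
    rw [integral_complex_ofReal, ← Complex.ofReal_pow, ← Complex.ofReal_mul, integral_mul_const,
      integral_const_mul]
    congr 1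
    ring
  rw [setIntegral_congr_fun measurableSet_Ioi hr, integral_complex_ofReal, integral_mul_const,
    Complex.ofReal_inj, integral_Ioi_pow_mul_exp, integral_Ioi_pow_mul_exp] at h
  have hG : Real.Gamma (((m + 2 : ℕ) + 1) / 2) = (m + 1) / 2 * Real.Gamma ((m + 1) / 2) := by
    rw [← Real.Gamma_add_one (by positivity)]
    congr 1
    push_cast
    ring
  have hpos : 0 < Real.Gamma (((m : ℝ) + 1) / 2) := Real.Gamma_pos_of_pos (by positivity)
  rw [hG] at h
  rw [integral_pow]
  have h' := mul_left_cancel₀ hpos.ne' (b := Real.pi * (1 + (-1) ^ m) / 2)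
    (c := (m + 1) / 4 * ∫ z : Sph, (inner ℝ n (z : Space)) ^ m ∂sphMeasure)
    (by linear_combination h)
  have hm : (0 : ℝ) < m + 1 := by positivity
  rw [one_pow, pow_succ]
  field_simp
  linear_combination (-4 : ℝ) * h'

lemma integral_sphere_polynomial {n : Space} (hn : ‖n‖ = 1) (p : Polynomial ℝ) :
    ∫ z : Sph, p.eval (inner ℝ n (z : Space)) ∂sphMeasure
      = 2 * Real.pi * ∫ t in (-1 : ℝ)..1, p.eval t := by
  have hc : Continuous fun z : Sph => (inner ℝ n (z : Space) : ℝ) := by fun_prop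
  have hi : ∀ q : Polynomial ℝ, Integrable (fun z : Sph => q.eval (inner ℝ n (z : Space)))
      sphMeasure := fun q =>
    (q.continuous.comp hc).integrable_of_hasCompactSupport (HasCompactSupport.of_compactSpace _)
  induction p using Polynomial.induction_on' with
  | add p q hp hq =>
    simp only [Polynomial.eval_add]
    rw [integral_add (hi p) (hi q), hp, hq, intervalIntegral.integral_add
      (p.continuous.intervalIntegrable _ _) (q.continuous.intervalIntegrable _ _)]
    ring
  | monomial m a =>
    simp only [Polynomial.eval_monomial]
    rw [integral_const_mul, integral_sphere_inner_pow hn, intervalIntegral.integral_const_mul]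
    ring

lemma inner_sphere_mem {n : Space} (hn : ‖n‖ = 1) (z : Sph) :
    (inner ℝ n (z : Space) : ℝ) ∈ Set.Icc (-1 : ℝ) 1 := by
  have h := abs_real_inner_le_norm n (z : Space)
  have hz : ‖(z : Space)‖ = 1 := by simp
  rw [hn, hz, mul_one] at h
  exact abs_le.1 h

lemma integral_sphere_real {n : Space} (hn : ‖n‖ = 1) {F : ℝ → ℝ}
    (hF : ContinuousOn F (Set.Icc (-1) 1)) :
    ∫ z : Sph, F (inner ℝ n (z : Space)) ∂sphMeasure
      = 2 * Real.pi * ∫ t in (-1 : ℝ)..1, F t := by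
  have hc : Continuous fun z : Sph => (inner ℝ n (z : Space) : ℝ) := by fun_prop
  have hi : Integrable (fun z : Sph => F (inner ℝ n (z : Space))) sphMeasure :=
    (hF.comp_continuous hc (inner_sphere_mem hn)).integrable_of_hasCompactSupport
      (HasCompactSupport.of_compactSpace _)
  have hFi : IntervalIntegrable F volume (-1) 1 := by
    apply ContinuousOn.intervalIntegrable
    rwa [Set.uIcc_of_le (by norm_num)]
  -- With a polynomial within `ε / K` of `F`, the errors on the sphere and on `[-1, 1]` (length two,
  -- weight `2π`) add up to exactly `ε`.
  set K : ℝ := sphMeasure.real Set.univ + 4 * Real.pi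
  have hK : 0 < K := by positivity
  refine eq_of_forall_dist_le fun ε hε => ?_
  rw [Real.dist_eq]
  obtain ⟨p, hp⟩ := exists_polynomial_near_of_continuousOn (-1) 1 F hF (ε / K) (by positivity)
  have hip : Integrable (fun z : Sph => p.eval (inner ℝ n (z : Space))) sphMeasure :=
    (p.continuous.comp hc).integrable_of_hasCompactSupport (HasCompactSupport.of_compactSpace _)
  have e1 : |∫ z : Sph, F (inner ℝ n (z : Space)) ∂sphMeasure
      - ∫ z : Sph, p.eval (inner ℝ n (z : Space)) ∂sphMeasure|
      ≤ ε / K * sphMeasure.real Set.univ := by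
    rw [← integral_sub hi hip, ← Real.norm_eq_abs]
    refine norm_integral_le_of_norm_le_const (ae_of_all _ fun z => ?_)
    rw [Real.norm_eq_abs, abs_sub_comm]
    exact (hp _ (inner_sphere_mem hn z)).le
  have e2 : |(∫ t in (-1 : ℝ)..1, F t) - ∫ t in (-1 : ℝ)..1, p.eval t| ≤ ε / K * 2 := by
    rw [← intervalIntegral.integral_sub hFi (p.continuous.intervalIntegrable _ _),
      ← Real.norm_eq_abs]
    refine (intervalIntegral.norm_integral_le_of_norm_le_const (C := ε / K) fun t ht => ?_).trans
      (by norm_num)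
    rw [Set.uIoc_of_le (by norm_num)] at ht
    rw [Real.norm_eq_abs, abs_sub_comm]
    exact (hp t ⟨ht.1.le, ht.2⟩).le
  rw [integral_sphere_polynomial hn] at e1
  have hpi := Real.pi_pos
  calc _ ≤ |∫ z : Sph, F (inner ℝ n (z : Space)) ∂sphMeasure
          - 2 * Real.pi * ∫ t in (-1 : ℝ)..1, p.eval t|
        + |2 * Real.pi * ((∫ t in (-1 : ℝ)..1, F t) - ∫ t in (-1 : ℝ)..1, p.eval t)| := by
        rw [mul_sub, abs_sub_comm (2 * Real.pi * ∫ t in (-1 : ℝ)..1, F t)]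
        exact abs_sub_le _ _ _
    _ ≤ ε / K * sphMeasure.real Set.univ + 2 * Real.pi * (ε / K * 2) := by
        rw [abs_mul, abs_of_pos (by positivity : 0 < 2 * Real.pi)]
        gcongr
    _ = ε := by
        simp only [K]
        field_simp
        ring

/-- Archimedes' hat-box theorem. -/
lemma integral_sphere {n : Space} (hn : ‖n‖ = 1) {F : ℝ → ℂ}
    (hF : ContinuousOn F (Set.Icc (-1) 1)) :
    ∫ z : Sph, F (inner ℝ n (z : Space)) ∂sphMeasure
      = 2 * Real.pi * ∫ t in (-1 : ℝ)..1, F t := by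
  have hc : Continuous fun z : Sph => (inner ℝ n (z : Space) : ℝ) := by fun_prop
  have hi : Integrable (fun z : Sph => F (inner ℝ n (z : Space))) sphMeasure :=
    (hF.comp_continuous hc (inner_sphere_mem hn)).integrable_of_hasCompactSupport
      (HasCompactSupport.of_compactSpace _)
  have hFi : IntervalIntegrable F volume (-1) 1 := by
    apply ContinuousOn.intervalIntegrable
    rwa [Set.uIcc_of_le (by norm_num)]
  have r1 := integral_sphere_real hn (Complex.continuous_re.comp_continuousOn hF)
  have r2 := integral_sphere_real hn (Complex.continuous_im.comp_continuousOn hF)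
  have s1 := Complex.reCLM.integral_comp_comm hi
  have s2 := Complex.imCLM.integral_comp_comm hi
  have s3 := Complex.reCLM.intervalIntegral_comp_comm hFi
  have s4 := Complex.imCLM.intervalIntegral_comp_comm hFi
  simp only [Complex.reCLM_apply, Complex.imCLM_apply, Function.comp_apply] at r1 r2 s1 s2 s3 s4
  have e : (2 * Real.pi : ℂ) = ((2 * Real.pi : ℝ) : ℂ) := by push_cast; ring
  rw [e]
  apply Complex.ext
  · rw [Complex.re_ofReal_mul, ← s1, r1, s3]
  · rw [Complex.im_ofReal_mul, ← s2, r2, s4]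

/-! ### The Laplacian of axially symmetric test functions. -/

/-- The function `v(r) / r * P(cos θ)` with axis the unit vector `n`. -/
def axial (n : Space) (v : ℝ → ℝ) (P : Polynomial ℝ) (x : Space) : ℝ :=
  v ‖x‖ / ‖x‖ * P.eval (inner ℝ n x / ‖x‖)

lemma axial_eventuallyEq_zero {n : Space} {v : ℝ → ℝ} (hv : IsTest v) (P : Polynomial ℝ) :
    axial n v P =ᶠ[𝓝 0] 0 := by
  obtain ⟨a, b, ha, -, hs⟩ := hv.exists_Icc
  filter_upwards [Metric.ball_mem_nhds (0 : Space) ha] with x hx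
  have : v ‖x‖ = 0 := image_eq_zero_of_notMem_tsupport fun h => by
    have := (hs h).1
    rw [mem_ball_zero_iff] at hx
    linarith
  simp [axial, this]

/-- The norm is not smooth at the origin, but `v` vanishes near zero. -/
lemma contDiff_axial (n : Space) {v : ℝ → ℝ} (hv : IsTest v) (P : Polynomial ℝ) :
    ContDiff ℝ ∞ (axial n v P) := by
  rw [contDiff_iff_contDiffAt]
  intro x
  by_cases hx : x = 0
  · subst hx
    exact contDiffAt_const.congr_of_eventuallyEq (axial_eventuallyEq_zero hv P)
  · have h1 : ContDiffAt ℝ ∞ (fun x : Space => ‖x‖) x := contDiffAt_norm ℝ hx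
    have h0 : ‖x‖ ≠ 0 := norm_ne_zero_iff.2 hx
    have h2 : ContDiffAt ℝ ∞ (fun x : Space => (inner ℝ n x : ℝ) / ‖x‖) x :=
      (contDiff_const.inner ℝ contDiff_id).contDiffAt.div h1 h0
    have h3 : ContDiff ℝ ∞ (fun t : ℝ => P.eval t) := by
      simpa using P.contDiff_aeval (𝕜 := ℝ) ∞
    exact ((hv.contDiff.contDiffAt.comp x h1).div h1 h0).mul (h3.contDiffAt.comp x h2)

lemma hasCompactSupport_axial (n : Space) {v : ℝ → ℝ} (hv : IsTest v) (P : Polynomial ℝ) :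
    HasCompactSupport (axial n v P) := by
  obtain ⟨a, b, ha, -, hs⟩ := hv.exists_Icc
  refine HasCompactSupport.intro (isCompact_closedBall (0 : Space) b) fun x hx => ?_
  have : v ‖x‖ = 0 := image_eq_zero_of_notMem_tsupport fun h => by
    have := (hs h).2
    rw [mem_closedBall_zero_iff, not_le] at hx
    linarith
  simp [axial, this]

lemma hasDerivAt_norm_line {x e : Space} (hx : x ≠ 0) :
    HasDerivAt (fun s : ℝ => ‖x + s • e‖) (inner ℝ x e / ‖x‖) 0 := by
  have h0 : ‖x‖ ≠ 0 := norm_ne_zero_iff.2 hx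
  have h1 : HasDerivAt (fun s : ℝ => x + s • e) e 0 := by
    simpa using ((hasDerivAt_id (0 : ℝ)).smul_const e).const_add x
  have h2 := (h1.norm_sq).sqrt (by simpa using h0)
  simp only [Real.sqrt_sq (norm_nonneg _), zero_smul, add_zero] at h2
  refine h2.congr_deriv ?_
  field_simp

/-- First derivatives of `q(r) P(⟪n, x⟫ / r)`. -/
lemma hasDerivAt_radial_line {n x e : Space} (hx : x ≠ 0) {q P : ℝ → ℝ} {q' P' : ℝ}
    (hq : HasDerivAt q q' ‖x‖) (hP : HasDerivAt P P' (inner ℝ n x / ‖x‖)) :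
    HasDerivAt (fun s : ℝ => q ‖x + s • e‖ * P (inner ℝ n (x + s • e) / ‖x + s • e‖))
      (q' * (inner ℝ x e / ‖x‖) * P (inner ℝ n x / ‖x‖)
        + q ‖x‖ * (P' * (inner ℝ n e / ‖x‖ - inner ℝ n x * inner ℝ x e / ‖x‖ ^ 3))) 0 := by
  have h0 : ‖x‖ ≠ 0 := norm_ne_zero_iff.2 hx
  have h1 := hasDerivAt_norm_line (e := e) hx
  have h2 : HasDerivAt (fun s : ℝ => (inner ℝ n (x + s • e) : ℝ)) (inner ℝ n e) 0 := by
    simp only [inner_add_right, inner_smul_right]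
    simpa using ((hasDerivAt_id (0 : ℝ)).mul_const (inner ℝ n e : ℝ)).const_add (inner ℝ n x : ℝ)
  have h3 := h2.div h1 (by simpa using h0)
  have e0 : ‖x + (0 : ℝ) • e‖ = ‖x‖ := by simp
  have hq' : HasDerivAt q q' ‖x + (0 : ℝ) • e‖ := by rwa [e0]
  have hP' : HasDerivAt P P' (inner ℝ n (x + (0 : ℝ) • e) / ‖x + (0 : ℝ) • e‖) := by
    simpa using hP
  have h4 := (hq'.comp 0 h1).mul (hP'.comp 0 h3)
  refine h4.congr_deriv ?_
  simp only [Function.comp, Pi.div_apply, zero_smul, add_zero]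
  field_simp

lemma hasDerivAt_line (x e : Space) : HasDerivAt (fun s : ℝ => x + s • e) e 0 := by
  simpa using ((hasDerivAt_id (0 : ℝ)).smul_const e).const_add x

lemma IsTest.hasDerivAt {v : ℝ → ℝ} (hv : IsTest v) (r : ℝ) : HasDerivAt v (deriv v r) r :=
  ((hv.contDiff.differentiable (by simp)) r).hasDerivAt

lemma fderiv_axial (n : Space) {v : ℝ → ℝ} (hv : IsTest v) (P : Polynomial ℝ) {y : Space}
    (hy : y ≠ 0) (e : Space) : fderiv ℝ (axial n v P) y e
      = (deriv v ‖y‖ * ‖y‖ - v ‖y‖) / ‖y‖ ^ 3 * P.eval (inner ℝ n y / ‖y‖) * inner ℝ y e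
        + v ‖y‖ / ‖y‖ ^ 2 * P.derivative.eval (inner ℝ n y / ‖y‖) * inner ℝ n e
        - v ‖y‖ / ‖y‖ ^ 4 * P.derivative.eval (inner ℝ n y / ‖y‖) * inner ℝ n y
          * inner ℝ y e := by
  have h0 : ‖y‖ ≠ 0 := norm_ne_zero_iff.2 hy
  have hq : HasDerivAt (fun r => v r / r) ((deriv v ‖y‖ * ‖y‖ - v ‖y‖) / ‖y‖ ^ 2) ‖y‖ :=
    ((hv.hasDerivAt _).div (hasDerivAt_id _) h0).congr_deriv (by simp)
  have h1 := hasDerivAt_radial_line (e := e) hy hq (P.hasDerivAt (inner ℝ n y / ‖y‖))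
  have hy' : HasFDerivAt (axial n v P) (fderiv ℝ (axial n v P) y) (y + (0 : ℝ) • e) := by
    rw [zero_smul, add_zero]
    exact ((contDiff_axial n hv P).differentiable (by simp) y).hasFDerivAt
  have h2 := hy'.comp_hasDerivAt 0 (hasDerivAt_line y e)
  rw [h2.unique h1]
  field_simp
  ring

lemma hasDerivAt_fderiv_axial (n : Space) {v : ℝ → ℝ} (hv : IsTest v) (P : Polynomial ℝ)
    (x e : Space) : HasDerivAt (fun s : ℝ => fderiv ℝ (axial n v P) (x + s • e) e)
      (iteratedFDeriv ℝ 2 (axial n v P) x ![e, e]) 0 := by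
  rw [iteratedFDeriv_two_apply]
  simp only [Matrix.cons_val_zero, Matrix.cons_val_one]
  have hF : HasFDerivAt (fderiv ℝ (axial n v P)) (fderiv ℝ (fderiv ℝ (axial n v P)) x)
      (x + (0 : ℝ) • e) := by
    rw [zero_smul, add_zero]
    have h2 : ContDiff ℝ 2 (axial n v P) := (contDiff_axial n hv P).of_le (by norm_cast)
    exact ((h2.fderiv_right (m := 1) (by norm_num)).differentiable one_ne_zero x).hasFDerivAt
  exact (ContinuousLinearMap.apply ℝ ℝ e).hasFDerivAt.comp_hasDerivAt 0
    (hF.comp_hasDerivAt 0 (hasDerivAt_line x e))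

/-- The result is sorted as a quadratic form in `⟪x, e⟫` and `⟪n, e⟫` plus a constant, so that the
sum over an orthonormal basis needs only Parseval's identity for the pairs formed from `x` and `n`.
The equations among the hypotheses serve as abbreviations. -/
lemma iteratedFDeriv_axial (n : Space) {v : ℝ → ℝ} (hv : IsTest v) (P : Polynomial ℝ)
    {x e : Space} (hx : x ≠ 0) (he : ‖e‖ = 1) {r c p p1 p2 A A' B' D' : ℝ} (hr : ‖x‖ = r)
    (hc : inner ℝ n x = c) (hp : P.eval (c / r) = p) (hp1 : P.derivative.eval (c / r) = p1)
    (hp2 : P.derivative.derivative.eval (c / r) = p2)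
    (hA : A = (deriv v r * r - v r) / r ^ 3)
    (hA' : A' = deriv (deriv v) r / r ^ 2 - 3 * (deriv v r * r - v r) / r ^ 4)
    (hB' : B' = deriv v r / r ^ 2 - 2 * v r / r ^ 3)
    (hD' : D' = deriv v r / r ^ 4 - 4 * v r / r ^ 5) :
    iteratedFDeriv ℝ 2 (axial n v P) x ![e, e]
      = (A' * p / r - A * p1 * c / r ^ 3 - D' * p1 * c / r + v r / r ^ 4 * p2 * c ^ 2 / r ^ 3)
          * (inner ℝ x e * inner ℝ x e)
        + (A * p1 / r + B' * p1 / r - v r / r ^ 2 * p2 * c / r ^ 3 - v r / r ^ 4 * p2 * c / r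
          - v r / r ^ 4 * p1) * (inner ℝ n e * inner ℝ x e)
        + v r / r ^ 2 * p2 / r * (inner ℝ n e * inner ℝ n e)
        + (A * p - v r / r ^ 4 * p1 * c) := by
  have hne : r ≠ 0 := hr ▸ norm_ne_zero_iff.2 hx
  have hdA : HasDerivAt (fun r => (deriv v r * r - v r) / r ^ 3) A' ‖x‖ := by
    rw [hr]
    refine ((((hv.derivative.hasDerivAt r).mul (hasDerivAt_id r)).sub (hv.hasDerivAt r)).div
      ((hasDerivAt_id r).pow 3) (pow_ne_zero _ hne)).congr_deriv ?_
    simp [hA']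
    field_simp
  have hdB : HasDerivAt (fun r => v r / r ^ 2) B' ‖x‖ := by
    rw [hr]
    refine ((hv.hasDerivAt r).div ((hasDerivAt_id r).pow 2) (pow_ne_zero _ hne)).congr_deriv ?_
    simp [hB']
    field_simp
  have hdD : HasDerivAt (fun r => v r / r ^ 4) D' ‖x‖ := by
    rw [hr]
    refine ((hv.hasDerivAt r).div ((hasDerivAt_id r).pow 4) (pow_ne_zero _ hne)).congr_deriv ?_
    simp [hD']
    field_simp
  have hu : HasDerivAt (fun s : ℝ => (inner ℝ (x + s • e) e : ℝ)) 1 0 := by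
    simp only [inner_add_left, inner_smul_left, real_inner_self_eq_norm_sq, he]
    simpa using (hasDerivAt_id (0 : ℝ)).const_add (inner ℝ x e : ℝ)
  have hcn : HasDerivAt (fun s : ℝ => (inner ℝ n (x + s • e) : ℝ)) (inner ℝ n e) 0 := by
    simp only [inner_add_right, inner_smul_right]
    simpa using ((hasDerivAt_id (0 : ℝ)).mul_const (inner ℝ n e : ℝ)).const_add
      (inner ℝ n x : ℝ)
  have g1 := (hasDerivAt_radial_line (e := e) hx hdA (P.hasDerivAt (inner ℝ n x / ‖x‖))).fun_mul hu
  have g2 := (hasDerivAt_radial_line (e := e) hx hdB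
    (P.derivative.hasDerivAt (inner ℝ n x / ‖x‖))).mul_const (inner ℝ n e : ℝ)
  have g3 := ((hasDerivAt_radial_line (e := e) hx hdD
    (P.derivative.hasDerivAt (inner ℝ n x / ‖x‖))).fun_mul hcn).fun_mul hu
  have g := (g1.fun_add g2).fun_sub g3
  have hcont : ContinuousAt (fun s : ℝ => x + s • e) 0 := (hasDerivAt_line x e).continuousAt
  have hne0 : ∀ᶠ s : ℝ in 𝓝 0, x + s • e ≠ 0 := hcont.eventually_ne (by simpa using hx)
  rw [(hasDerivAt_fderiv_axial n hv P x e).unique (g.congr_of_eventuallyEq (by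
    filter_upwards [hne0] with s hs
    exact fderiv_axial n hv P hs e))]
  simp only [zero_smul, add_zero, hr, hc, hp, hp1, hp2, ← hA]
  ring

/-- The factor `1 / r` removes the first-order term of the radial Laplacian, and Legendre's equation
turns the angular part into multiplication by `-l(l+1)/r²`. -/
lemma laplacian_axial {n : Space} (hn : ‖n‖ = 1) {v : ℝ → ℝ} (hv : IsTest v) (l : ℕ) {x : Space}
    (hx : x ≠ 0) :
    (Laplacian.laplacian (axial n v (legendre l)) : Space → ℝ) x
      = (deriv (deriv v) ‖x‖ - l * (l + 1) / ‖x‖ ^ 2 * v ‖x‖) / ‖x‖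
        * (legendre l).eval (inner ℝ n x / ‖x‖) := by
  have hne : ‖x‖ ≠ 0 := norm_ne_zero_iff.2 hx
  have hode := legendre_ode l (inner ℝ n x / ‖x‖)
  set b := EuclideanSpace.basisFun (Fin 3) ℝ
  rw [InnerProductSpace.laplacian_eq_iteratedFDeriv_orthonormalBasis _ b]
  simp only
  rw [Finset.sum_congr rfl fun i _ => iteratedFDeriv_axial n hv (legendre l) hx
    (b.orthonormal.1 i) rfl rfl rfl rfl rfl rfl rfl rfl rfl]
  have s1 : ∑ i, (inner ℝ x (b i) : ℝ) * inner ℝ x (b i) = ‖x‖ ^ 2 := by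
    have := b.sum_inner_mul_inner x x
    simp only [real_inner_comm x, real_inner_self_eq_norm_sq] at this ⊢
    exact this
  have s2 : ∑ i, (inner ℝ n (b i) : ℝ) * inner ℝ x (b i) = inner ℝ n x := by
    have := b.sum_inner_mul_inner n x
    simpa only [real_inner_comm x] using this
  have s3 : ∑ i, (inner ℝ n (b i) : ℝ) * inner ℝ n (b i) = 1 := by
    have := b.sum_inner_mul_inner n n
    simp only [real_inner_comm n, real_inner_self_eq_norm_sq, hn] at this ⊢
    simpa using this
  simp only [Finset.sum_add_distrib, ← Finset.mul_sum]
  rw [s1, s2, s3]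
  simp only [Finset.sum_const, Finset.card_univ, Fintype.card_fin, nsmul_eq_mul, Nat.cast_ofNat]
  generalize (legendre l).eval (inner ℝ n x / ‖x‖) = p at *
  generalize (legendre l).derivative.eval (inner ℝ n x / ‖x‖) = p1 at *
  generalize (legendre l).derivative.derivative.eval (inner ℝ n x / ‖x‖) = p2 at *
  generalize (inner ℝ n x : ℝ) = c at *
  generalize ‖x‖ = r at *
  -- Legendre's equation at `cos θ = c / r`, solved for `l(l+1) P_l`.
  have hode' : l * (l + 1) * p = -((r ^ 2 - c ^ 2) * p2 - 2 * c * r * p1) / r ^ 2 := by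
    field_simp at hode ⊢
    linear_combination hode
  have : (deriv (deriv v) r - l * (l + 1) / r ^ 2 * v r) / r * p
      = deriv (deriv v) r / r * p - (l * (l + 1) * p) * v r / r ^ 3 := by
    field_simp
  rw [this, hode']
  field_simp
  ring

/-! ### Projection to a partial wave and the radial equation. -/

/-- The projection of `ψ` to the partial wave `l` with axis `n`, at radius `r`. -/
def proj (n : Space) (l : ℕ) (ψ : Space → ℂ) (r : ℝ) : ℂ :=
  ∫ z : Sph, ψ (r • (z : Space)) * (((legendre l).eval (inner ℝ n (z : Space)) : ℝ) : ℂ)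
    ∂sphMeasure

/-- The coefficient of the radial equation. -/
def radialCoeff (M : ℝ) (V : ℝ → ℝ) (E : ℝ) (l : ℕ) (r : ℝ) : ℝ :=
  l * (l + 1) / r ^ 2 + 2 * M * V r - 2 * M * E

lemma norm_smul_sph {r : ℝ} (hr : 0 < r) (z : Sph) : ‖r • (z : Space)‖ = r := by
  rw [norm_smul, norm_eq_of_mem_sphere, mul_one, Real.norm_of_nonneg hr.le]

lemma inner_smul_sph (n : Space) {r : ℝ} (hr : 0 < r) (z : Sph) :
    (inner ℝ n (r • (z : Space)) : ℝ) / ‖r • (z : Space)‖ = inner ℝ n (z : Space) := by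
  rw [norm_smul_sph hr, inner_smul_right, mul_div_cancel_left₀ _ hr.ne']

lemma continuous_legendre_sph (n : Space) (l : ℕ) :
    Continuous fun z : Sph => (((legendre l).eval (inner ℝ n (z : Space)) : ℝ) : ℂ) := by
  have : Continuous fun z : Sph => (inner ℝ n (z : Space) : ℝ) := by fun_prop
  exact Complex.continuous_ofReal.comp ((legendre l).continuous.comp this)

lemma continuous_proj (n : Space) (l : ℕ) {ψ : Space → ℂ} (hψ : Continuous ψ) :
    Continuous (proj n l ψ) := by
  have h : Continuous (Function.uncurry fun (r : ℝ) (z : Sph) =>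
      ψ (r • (z : Space)) * (((legendre l).eval (inner ℝ n (z : Space)) : ℝ) : ℂ)) := by
    have h1 : Continuous fun p : ℝ × Sph => p.1 • (p.2 : Space) := by fun_prop
    exact (hψ.comp h1).mul ((continuous_legendre_sph n l).comp continuous_snd)
  have := continuous_parametric_integral_of_continuous (μ := sphMeasure) h isCompact_univ
  rw [Measure.restrict_univ] at this
  exact this

lemma locallyIntegrableOn_Ioi {f : ℝ → ℂ}
    (h : ∀ a b : ℝ, 0 < a → IntegrableOn f (Set.Icc a b)) : LocallyIntegrableOn f (Set.Ioi 0) := by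
  intro x hx
  have hx' : (0 : ℝ) < x := hx
  exact ⟨Set.Icc (x / 2) (x + 1), mem_nhdsWithin_of_mem_nhds
    (Icc_mem_nhds (by linarith) (by linarith)), h _ _ (by positivity)⟩

lemma integrable_mul_legendre {n : Space} (l : ℕ) {h : Space → ℂ} (hh : Integrable h) :
    Integrable fun x => h x * (((legendre l).eval (inner ℝ n x / ‖x‖) : ℝ) : ℂ) := by
  -- By Cauchy-Schwarz `⟪n, x⟫ / ‖x‖` stays in this interval, also at `x = 0`, where the quotient is
  -- zero.
  obtain ⟨C, hC⟩ := (isCompact_Icc (a := -‖n‖) (b := ‖n‖)).exists_bound_of_continuousOn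
    (legendre l).continuous.continuousOn
  refine hh.mul_bdd (c := C) ?_ (ae_of_all _ fun x => ?_)
  · have : Measurable fun x : Space => (inner ℝ n x : ℝ) / ‖x‖ := by fun_prop
    exact (Complex.measurable_ofReal.comp
      ((legendre l).continuous.measurable.comp this)).aestronglyMeasurable
  · rw [Complex.norm_real]
    refine hC _ (abs_le.1 ?_)
    rw [abs_div, abs_norm]
    exact div_le_of_le_mul₀ (norm_nonneg _) (norm_nonneg _) (abs_real_inner_le_norm n x)

lemma integrableOn_proj {n : Space} (l : ℕ) {h : Space → ℂ} (hh : Integrable h) :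
    IntegrableOn (fun r : ℝ => (r : ℂ) ^ 2 * proj n l h r) (Set.Ioi 0) := by
  refine (integrableOn_polar (integrable_mul_legendre (n := n) l hh)).congr_fun (fun r hr => ?_)
    measurableSet_Ioi
  simp only [proj, inner_smul_sph n (Set.mem_Ioi.1 hr)]

/-- Only radii up to `b` matter, so `h` may be cut off to a ball, where it is integrable. Away from
the origin the missing factor `r⁻¹` is continuous. -/
lemma integrableOn_proj_Icc {n : Space} (l : ℕ) {h : Space → ℂ} (hh : LocallyIntegrable h)
    {a b : ℝ} (ha : 0 < a) :
    IntegrableOn (fun r : ℝ => (r : ℂ) * proj n l h r) (Set.Icc a b) := by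
  have h1 : Integrable ((Metric.closedBall (0 : Space) b).indicator h) :=
    (hh.integrableOn_isCompact (isCompact_closedBall _ _)).integrable_indicator
      measurableSet_closedBall
  have h2 := (integrableOn_proj (n := n) l h1).mono_set
    (show Set.Icc a b ⊆ Set.Ioi 0 from fun r hr => ha.trans_le hr.1)
  have hc : ContinuousOn (fun r : ℝ => (r : ℂ)⁻¹) (Set.Icc a b) :=
    Complex.continuous_ofReal.continuousOn.inv₀ fun r hr => by
      exact_mod_cast (ha.trans_le hr.1).ne'
  refine (h2.continuousOn_mul hc isCompact_Icc).congr_fun (fun r hr => ?_) measurableSet_Icc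
  have hr0 : 0 < r := ha.trans_le hr.1
  have hr1 : (r : ℂ) ≠ 0 := by exact_mod_cast hr0.ne'
  have : proj n l ((Metric.closedBall (0 : Space) b).indicator h) r = proj n l h r := by
    refine integral_congr_ae (ae_of_all _ fun z => ?_)
    simp only
    rw [Set.indicator_of_mem]
    rw [mem_closedBall_zero_iff, norm_smul_sph hr0]
    exact hr.2
  simp only [this]
  field_simp

/-- The radial content of local integrability in `ℝ³`. It allows singular potentials and is what
controls the radial solutions at the origin. -/
lemma integrableOn_sq_mul_potential {V : ℝ → ℝ}
    (hV : LocallyIntegrable (fun x : Space => V ‖x‖) volume) (b : ℝ) :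
    IntegrableOn (fun r => r ^ 2 * V r) (Set.Ioo 0 b) := by
  have h1 : IntegrableOn (fun x : Space => V ‖x‖) (Metric.ball 0 b) :=
    (hV.integrableOn_isCompact (isCompact_closedBall (0 : Space) b)).mono_set
      Metric.ball_subset_closedBall
  have h2 := (integrableOn_fun_norm_addHaar volume).1 h1
  simpa using h2

lemma integrableOn_potential {V : ℝ → ℝ}
    (hV : LocallyIntegrable (fun x : Space => V ‖x‖) volume) {a b : ℝ} (ha : 0 < a) :
    IntegrableOn V (Set.Icc a b) := by
  have h2 := (integrableOn_sq_mul_potential hV (b + 1)).mono_set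
    (show Set.Icc a b ⊆ Set.Ioo 0 (b + 1) from fun r hr =>
      ⟨ha.trans_le hr.1, by linarith [hr.2]⟩)
  have hc : ContinuousOn (fun r : ℝ => (r ^ 2)⁻¹) (Set.Icc a b) :=
    (continuous_pow 2).continuousOn.inv₀ fun r hr => by
      have := (ha.trans_le hr.1).ne'
      positivity
  refine (h2.continuousOn_mul hc isCompact_Icc).congr_fun (fun r hr => ?_) measurableSet_Icc
  have := (ha.trans_le hr.1).ne'
  simp only
  field_simp

lemma integrableOn_radialCoeff (M E : ℝ) (l : ℕ) {V : ℝ → ℝ}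
    (hV : LocallyIntegrable (fun x : Space => V ‖x‖) volume) {a b : ℝ} (ha : 0 < a) :
    IntegrableOn (radialCoeff M V E l) (Set.Icc a b) := by
  have hc : ContinuousOn (fun r : ℝ => (l * (l + 1) : ℝ) / r ^ 2) (Set.Icc a b) :=
    continuousOn_const.div (continuous_pow 2).continuousOn fun r hr => by
      have := (ha.trans_le hr.1).ne'
      positivity
  exact ((hc.integrableOn_compact isCompact_Icc).add
    ((integrableOn_potential hV ha).const_mul (2 * M))).sub
      (continuousOn_const.integrableOn_compact isCompact_Icc)

/-- The complex-valued test function `v(r) / r * P_l(cos θ)`. -/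
def testWave (n : Space) (l : ℕ) (v : ℝ → ℝ) (x : Space) : ℂ := (axial n v (legendre l) x : ℂ)

lemma contDiff_testWave (n : Space) (l : ℕ) {v : ℝ → ℝ} (hv : IsTest v) :
    ContDiff ℝ ∞ (testWave n l v) :=
  Complex.ofRealCLM.contDiff.comp (contDiff_axial n hv (legendre l))

lemma hasCompactSupport_testWave (n : Space) (l : ℕ) {v : ℝ → ℝ} (hv : IsTest v) :
    HasCompactSupport (testWave n l v) :=
  (hasCompactSupport_axial n hv (legendre l)).comp_left (g := fun t : ℝ => (t : ℂ)) (by simp)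

/-- Needed to pass to polar coordinates. The potential term is a locally integrable function times a
continuous one of compact support; the other terms are continuous of compact support. -/
lemma integrable_mul_energySubHamiltonian (M E : ℝ) {V : ℝ → ℝ}
    (hV : LocallyIntegrable (fun x : Space => V ‖x‖) volume) {ψ g : Space → ℂ}
    (hψ : Continuous ψ) (hg : ContDiff ℝ ∞ g) (hgc : HasCompactSupport g) :
    Integrable fun x => ψ x * energySubHamiltonian M V E g x := by
  have hLc : Continuous (Laplacian.laplacian g : Space → ℂ) := by
    rw [InnerProductSpace.laplacian_eq_iteratedFDeriv_stdOrthonormalBasis]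
    refine continuous_finsetSum _ fun i _ => ?_
    have : Continuous (iteratedFDeriv ℝ 2 g) :=
      hg.continuous_iteratedFDeriv (m := 2) (by norm_cast)
    fun_prop
  have hLs : HasCompactSupport (Laplacian.laplacian g : Space → ℂ) := by
    refine hgc.mono' fun x hx => ?_
    by_contra hn
    refine hx ?_
    have h0 : g =ᶠ[𝓝 x] 0 := notMem_tsupport_iff_eventuallyEq.1 hn
    have h1 : (Laplacian.laplacian g : Space → ℂ) x
        = (Laplacian.laplacian (0 : Space → ℂ) : Space → ℂ) x :=
      (InnerProductSpace.laplacian_congr_nhds h0).eq_of_nhds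
    rw [h1, InnerProductSpace.laplacian_eq_iteratedFDeriv_stdOrthonormalBasis]
    simp
  have i1 : Integrable fun x => ψ x * ((E : ℂ) * g x) :=
    (hψ.mul (continuous_const.mul hg.continuous)).integrable_of_hasCompactSupport
      (hgc.mul_left.mul_left)
  have i2 : Integrable fun x => ψ x * ((1 / (2 * M) : ℂ)
      * (Laplacian.laplacian g : Space → ℂ) x) :=
    (hψ.mul (continuous_const.mul hLc)).integrable_of_hasCompactSupport
      (hLs.mul_left.mul_left)
  have i3 : Integrable fun x => (ψ x * g x) • ((V ‖x‖ : ℝ) : ℂ) := by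
    refine LocallyIntegrable.integrable_smul_left_of_hasCompactSupport ?_
      (hψ.mul hg.continuous) hgc.mul_left
    intro x
    obtain ⟨s, hs, hi⟩ := hV x
    exact ⟨s, hs, hi.ofReal⟩
  refine ((i1.add i2).sub i3).congr (ae_of_all _ fun x => ?_)
  simp only [energySubHamiltonian, Pi.add_apply, Pi.sub_apply, smul_eq_mul]
  ring

lemma energySubHamiltonian_testWave {M : ℝ} (hM : 0 < M) (V : ℝ → ℝ) (E : ℝ) {n : Space}
    (hn : ‖n‖ = 1) (l : ℕ) {v : ℝ → ℝ} (hv : IsTest v) {r : ℝ} (hr : 0 < r) (z : Sph) :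
    energySubHamiltonian M V E (testWave n l v) (r • (z : Space))
      = ((1 / (2 * M) * (deriv (deriv v) r - radialCoeff M V E l r * v r) / r
        * (legendre l).eval (inner ℝ n (z : Space)) : ℝ) : ℂ) := by
  have hx : r • (z : Space) ≠ 0 := by
    rw [← norm_ne_zero_iff, norm_smul_sph hr]
    exact hr.ne'
  have hL : (Laplacian.laplacian (testWave n l v) : Space → ℂ) (r • (z : Space))
      = (((Laplacian.laplacian (axial n v (legendre l)) : Space → ℝ) (r • (z : Space)) : ℝ) : ℂ) :=
    ContDiffAt.laplacian_CLM_comp_left (l := Complex.ofRealCLM)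
      ((contDiff_axial n hv (legendre l)).contDiffAt.of_le (by norm_cast))
  rw [energySubHamiltonian, hL, laplacian_axial hn hv l hx, testWave, axial,
    inner_smul_sph n hr, norm_smul_sph hr, radialCoeff]
  have h1 : (M : ℂ) ≠ 0 := by exact_mod_cast hM.ne'
  have h2 : (r : ℂ) ≠ 0 := by exact_mod_cast hr.ne'
  push_cast
  field_simp
  ring

/-- The radial equation: the partial waves of `ψ` satisfy it on `(0, ∞)`. -/
lemma exists_radial_equation {M : ℝ} (hM : 0 < M) {V : ℝ → ℝ}
    (hV : LocallyIntegrable (fun x : Space => V ‖x‖) volume) (E : ℝ) {n : Space} (hn : ‖n‖ = 1)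
    (l : ℕ) {ψ h : Space → ℂ} (hψ : Continuous ψ) (hh : HasSchrodingerViolation M V E ψ h) :
    ∃ A1 : ℝ → ℂ, IsPrim (fun r => r * proj n l ψ r) A1 ∧
      IsPrim A1 (fun r => radialCoeff M V E l r * (r * proj n l ψ r)
        + 2 * M * (r * proj n l h r)) := by
  have hA : Continuous fun r : ℝ => (r : ℂ) * proj n l ψ r :=
    Complex.continuous_ofReal.mul (continuous_proj n l hψ)
  have hAl : LocallyIntegrableOn (fun r : ℝ => (r : ℂ) * proj n l ψ r) (Set.Ioi 0) :=
    hA.continuousOn.locallyIntegrableOn measurableSet_Ioi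
  have hWA : LocallyIntegrableOn (fun r : ℝ => (radialCoeff M V E l r : ℂ) * (r * proj n l ψ r))
      (Set.Ioi 0) := locallyIntegrableOn_Ioi fun a b ha =>
    IntegrableOn.mul_continuousOn (integrableOn_radialCoeff M E l hV ha).ofReal hA.continuousOn
      isCompact_Icc
  have hH : LocallyIntegrableOn (fun r : ℝ => 2 * (M : ℂ) * (r * proj n l h r)) (Set.Ioi 0) :=
    locallyIntegrableOn_Ioi fun a b ha => (integrableOn_proj_Icc l hh.1 ha).const_mul _
  refine exists_isPrim_of_weak hA.continuousOn (hWA.add hH) fun v hv => ?_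
  -- For this test function both sides become one-dimensional integrals: the radial weight `r²` and
  -- the factor `1 / r` combine to the `r` in `r * proj`.
  have key := hh.2 (testWave n l v) (contDiff_testWave n l hv) (hasCompactSupport_testWave n l hv)
  have hgi : Integrable fun x => h x * testWave n l v x := by
    have := hh.1.integrable_smul_left_of_hasCompactSupport
      (contDiff_testWave n l hv).continuous (hasCompactSupport_testWave n l hv)
    refine this.congr (ae_of_all _ fun x => ?_)
    simp only [smul_eq_mul]
    ring
  rw [integral_polar (integrable_mul_energySubHamiltonian M E hV hψ (contDiff_testWave n l hv)
    (hasCompactSupport_testWave n l hv)), integral_polar hgi] at key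
  have hM' : (M : ℂ) ≠ 0 := by exact_mod_cast hM.ne'
  have e1 : ∀ r ∈ Set.Ioi (0 : ℝ), (r : ℂ) ^ 2 * ∫ z : Sph, ψ (r • (z : Space))
      * energySubHamiltonian M V E (testWave n l v) (r • (z : Space)) ∂sphMeasure
      = (1 / (2 * M) : ℂ) * (((deriv (deriv v) r : ℝ) : ℂ) * (r * proj n l ψ r)
        - (v r : ℂ) * (radialCoeff M V E l r * (r * proj n l ψ r))) := by
    intro r hr
    have hr0 : 0 < r := hr
    have hr1 : (r : ℂ) ≠ 0 := by exact_mod_cast hr0.ne'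
    have : ∀ z : Sph, ψ (r • (z : Space))
        * energySubHamiltonian M V E (testWave n l v) (r • (z : Space))
        = ((1 / (2 * M) * (deriv (deriv v) r - radialCoeff M V E l r * v r) / r : ℝ) : ℂ)
          * (ψ (r • (z : Space)) * (((legendre l).eval (inner ℝ n (z : Space)) : ℝ) : ℂ)) := by
      intro z
      rw [energySubHamiltonian_testWave hM V E hn l hv hr0 z]
      push_cast
      ring
    simp only [this]
    rw [integral_const_mul]
    change _ * (_ * proj n l ψ r) = _
    push_cast
    field_simp
  have e2 : ∀ r ∈ Set.Ioi (0 : ℝ), (r : ℂ) ^ 2 * ∫ z : Sph, h (r • (z : Space))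
      * testWave n l v (r • (z : Space)) ∂sphMeasure
      = (1 / (2 * M) : ℂ) * ((v r : ℂ) * (2 * M * (r * proj n l h r))) := by
    intro r hr
    have hr0 : 0 < r := hr
    have hr1 : (r : ℂ) ≠ 0 := by exact_mod_cast hr0.ne'
    have : ∀ z : Sph, h (r • (z : Space)) * testWave n l v (r • (z : Space))
        = ((v r / r : ℝ) : ℂ)
          * (h (r • (z : Space)) * (((legendre l).eval (inner ℝ n (z : Space)) : ℝ) : ℂ)) := by
      intro z
      rw [testWave, axial, inner_smul_sph n hr0, norm_smul_sph hr0]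
      push_cast
      ring
    simp only [this]
    rw [integral_const_mul]
    change _ * (_ * proj n l h r) = _
    push_cast
    field_simp
  rw [setIntegral_congr_fun measurableSet_Ioi e1, setIntegral_congr_fun measurableSet_Ioi e2,
    integral_const_mul, integral_const_mul, integral_sub
      (hv.derivative.derivative.locallyIntegrable_mul hAl) (hv.locallyIntegrable_mul hWA)] at key
  have key' := mul_left_cancel₀ (one_div_ne_zero (mul_ne_zero two_ne_zero hM')) key
  simp only [mul_add ((v _ : ℝ) : ℂ)]
  rw [integral_add (hv.locallyIntegrable_mul hWA) (hv.locallyIntegrable_mul hH), ← key']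
  ring

/-! ### Asymptotics and Wronskians of radial solutions. -/

lemma tendsto_mul_zero_of_bdd {F : Filter ℝ} {f g : ℝ → ℂ} {K : ℝ} (hf : Tendsto f F (𝓝 0))
    (hg : ∀ᶠ r in F, ‖g r‖ ≤ K) : Tendsto (fun r => f r * g r) F (𝓝 0) := by
  have hb : Tendsto (fun r => ‖f r‖ * K) F (𝓝 0) := by
    simpa using hf.norm.mul_const K
  refine squeeze_zero_norm' ?_ hb
  filter_upwards [hg] with r hr
  rw [norm_mul]
  gcongr

/-- The combination `α e^{iκr} + β e^{-iκr}`. -/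
def waves (κ : ℝ) (α β : ℂ) (r : ℝ) : ℂ :=
  α * Complex.exp (Complex.I * κ * r) + β * Complex.exp (-(Complex.I * κ * r))

lemma norm_exp_I (κ r : ℝ) : ‖Complex.exp (Complex.I * κ * r)‖ = 1 := by
  rw [mul_assoc, ← Complex.ofReal_mul, mul_comm, Complex.norm_exp_ofReal_mul_I]

lemma norm_exp_neg_I (κ r : ℝ) : ‖Complex.exp (-(Complex.I * κ * r))‖ = 1 := by
  rw [Complex.exp_neg, norm_inv, norm_exp_I, inv_one]

lemma norm_waves_le (κ : ℝ) (α β : ℂ) (r : ℝ) : ‖waves κ α β r‖ ≤ ‖α‖ + ‖β‖ := by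
  refine (norm_add_le _ _).trans ?_
  rw [norm_mul, norm_mul, norm_exp_I, norm_exp_neg_I, mul_one, mul_one]

lemma hasDerivAt_waves (κ : ℝ) (α β : ℂ) (r : ℝ) :
    HasDerivAt (waves κ α β) (waves κ (Complex.I * κ * α) (-(Complex.I * κ * β)) r) r := by
  have h0 : HasDerivAt (fun r : ℝ => Complex.I * κ * (r : ℂ)) (Complex.I * κ) r := by
    simpa using (Complex.ofRealCLM.hasDerivAt (x := r)).const_mul (Complex.I * κ)
  have h := (h0.cexp.const_mul α).add (h0.neg.cexp.const_mul β)
  refine h.congr_deriv ?_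
  simp only [waves, Pi.neg_apply]
  ring

lemma isPrim_waves (κ : ℝ) (α β : ℂ) :
    IsPrim (waves κ α β) (waves κ (Complex.I * κ * α) (-(Complex.I * κ * β))) :=
  isPrim_of_hasDerivAt (fun r _ => hasDerivAt_waves κ α β r)
    (continuous_iff_continuousAt.2 fun r => (hasDerivAt_waves κ _ _ r).continuousAt).continuousOn

lemma waves_second (κ : ℝ) (α β : ℂ) (r : ℝ) :
    waves κ (Complex.I * κ * (Complex.I * κ * α)) (-(Complex.I * κ * (-(Complex.I * κ * β)))) r
      = -(κ ^ 2 * waves κ α β r) := by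
  simp only [waves]
  linear_combination (κ ^ 2 * (α * Complex.exp (Complex.I * κ * r)
    + β * Complex.exp (-(Complex.I * κ * r)))) * Complex.I_sq

/-- The Wronskian identity. -/
lemma IsPrim.wronskian {W a a1 p p1 H : ℝ → ℂ} (ha : IsPrim a a1)
    (ha1 : IsPrim a1 fun r => W r * a r) (hp : IsPrim p p1)
    (hp1 : IsPrim p1 fun r => W r * p r + H r) :
    IsPrim (fun r => a r * p1 r - p r * a1 r) (fun r => a r * H r) :=
  ((ha.mul hp1).sub (hp.mul ha1)).congr' fun r _ => by ring

lemma tendsto_integral_add_one {g : ℝ → ℝ} (hg : IntegrableOn g (Set.Ioi 0)) :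
    Tendsto (fun R => ∫ x in R..R + 1, g x) atTop (𝓝 0) := by
  have h1 := intervalIntegral_tendsto_integral_Ioi (0 : ℝ) hg tendsto_id
  have h2 := intervalIntegral_tendsto_integral_Ioi (0 : ℝ) hg
    (tendsto_atTop_add_const_right atTop (1 : ℝ) tendsto_id)
  have h3 := h2.sub h1
  rw [sub_self] at h3
  refine h3.congr' ?_
  filter_upwards [eventually_ge_atTop 0] with R hR
  have hi : ∀ c, 0 ≤ c → IntervalIntegrable g volume 0 c := fun c hc =>
    (intervalIntegrable_iff_integrableOn_Ioc_of_le hc).2 (hg.mono_set fun x hx => hx.1)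
  exact intervalIntegral.integral_interval_sub_left (hi _ (by simp; linarith)) (hi _ hR)

/-- Asymptotics of the derivative of a solution of a radial equation. -/
lemma tendsto_deriv_sub_waves {W : ℝ → ℝ} {κ : ℝ} {u u1 H : ℝ → ℂ} {α β : ℂ}
    (hW : Tendsto W atTop (𝓝 (-κ ^ 2))) (hu : IsPrim u u1)
    (hu1 : IsPrim u1 fun r => W r * u r + H r)
    (hH : IntegrableOn (fun r : ℝ => (r : ℂ) * H r) (Set.Ioi 0))
    (h : Tendsto (fun r => u r - waves κ α β r) atTop (𝓝 0)) :
    Tendsto (fun r => u1 r - waves κ (Complex.I * κ * α) (-(Complex.I * κ * β)) r)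
      atTop (𝓝 0) := by
  have hw := hu.sub (isPrim_waves κ α β)
  have hw1 := hu1.sub (isPrim_waves κ (Complex.I * κ * α) (-(Complex.I * κ * β)))
  refine tendsto_zero_of_isPrim hw hw1 h ?_
  simp only [waves_second]
  -- The second derivative of the error is `(W + κ²) u - κ² (u - waves) + H`. The first two terms
  -- are small pointwise, `H` only in mean over unit intervals.
  have hsmall : Tendsto (fun r => ((W r + κ ^ 2 : ℝ) : ℂ) * u r
      - κ ^ 2 * (u r - waves κ α β r)) atTop (𝓝 0) := by
    have h1 : Tendsto (fun r => ((W r + κ ^ 2 : ℝ) : ℂ)) atTop (𝓝 0) := by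
      have : Tendsto (fun r => W r + κ ^ 2) atTop (𝓝 0) := by
        have := hW.add_const (κ ^ 2)
        rwa [neg_add_cancel] at this
      have h1 := (Complex.continuous_ofReal.tendsto _).comp this
      rwa [Complex.ofReal_zero] at h1
    have h2 : ∀ᶠ r in atTop, ‖u r‖ ≤ 1 + (‖α‖ + ‖β‖) := by
      have := h.norm
      rw [norm_zero] at this
      filter_upwards [this.eventually_le_const one_pos] with r hr
      calc ‖u r‖ = ‖(u r - waves κ α β r) + waves κ α β r‖ := by rw [sub_add_cancel]
        _ ≤ _ := (norm_add_le _ _).trans (add_le_add hr (norm_waves_le _ _ _ _))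
    simpa using (tendsto_mul_zero_of_bdd h1 h2).sub (h.const_mul ((κ : ℂ) ^ 2))
  have hT := tendsto_integral_add_one hH.norm
  rw [Metric.tendsto_atTop]
  intro ε hε
  have e1 := hsmall.norm
  rw [norm_zero] at e1
  obtain ⟨R1, hR1⟩ := eventually_atTop.1 (e1.eventually_le_const (half_pos hε))
  obtain ⟨R2, hR2⟩ := eventually_atTop.1 (hT.eventually_lt_const (half_pos hε))
  refine ⟨max (max R1 R2) 1, fun R hR => ?_⟩
  have hRR1 : R1 ≤ R := (le_max_left _ _).trans ((le_max_left _ _).trans hR)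
  have hRR2 : R2 ≤ R := (le_max_right _ _).trans ((le_max_left _ _).trans hR)
  have hRR3 : 1 ≤ R := (le_max_right _ _).trans hR
  have hR0 : 0 < R := one_pos.trans_le hRR3
  have hrH : IntervalIntegrable (fun r : ℝ => ‖(r : ℂ) * H r‖) volume R (R + 1) :=
    (intervalIntegrable_iff_integrableOn_Ioc_of_le (by linarith)).2
      (hH.mono_set fun x hx => hR0.trans hx.1).norm
  have hi := (hw1 R (R + 1) hR0 (by linarith)).1
  simp only [waves_second] at hi
  have hle : ∫ x in R..R + 1, ‖(W x : ℂ) * u x + H x - -((κ : ℂ) ^ 2 * waves κ α β x)‖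
      ≤ ∫ x in R..R + 1, (ε / 2 + ‖(x : ℂ) * H x‖) := by
    refine intervalIntegral.integral_mono_on (by linarith) hi.norm
      ((by simp : IntervalIntegrable (fun _ => ε / 2) volume R (R + 1)).add hrH) fun x hx => ?_
    have hx1 : 1 ≤ x := hRR3.trans hx.1
    have e2 : (W x : ℂ) * u x + H x - -((κ : ℂ) ^ 2 * waves κ α β x)
        = (((W x + κ ^ 2 : ℝ) : ℂ) * u x - κ ^ 2 * (u x - waves κ α β x)) + H x := by
      push_cast
      ring
    rw [e2]
    refine (norm_add_le _ _).trans (add_le_add (hR1 x (hRR1.trans hx.1)) ?_)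
    rw [norm_mul, Complex.norm_real, Real.norm_of_nonneg (by linarith)]
    exact le_mul_of_one_le_left (norm_nonneg _) hx1
  rw [intervalIntegral.integral_add (by simp) hrH, intervalIntegral.integral_const] at hle
  rw [Real.dist_eq, sub_zero, abs_of_nonneg
    (intervalIntegral.integral_nonneg (by linarith) fun _ _ => norm_nonneg _)]
  have := hR2 R hRR2
  simp only [add_sub_cancel_left, one_smul] at hle
  linarith

/-- Behaviour at the origin of the derivative of a regular solution of a radial equation. -/
lemma tendsto_mul_deriv_zero {W : ℝ → ℝ} {u u1 H : ℝ → ℂ} {C : ℝ} (hu : IsPrim u u1)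
    (hu1 : IsPrim u1 fun r => W r * u r + H r)
    (hW : IntegrableOn (fun r => r ^ 2 * W r) (Set.Ioc 0 1))
    (hH : IntegrableOn (fun r : ℝ => (r : ℂ) * H r) (Set.Ioc 0 1))
    (hC : ∀ r, 0 < r → r ≤ 1 → ‖u r‖ ≤ C * r) :
    Tendsto (fun r : ℝ => (r : ℂ) * u1 r) (𝓝[>] 0) (𝓝 0) := by
  refine tendsto_mul_zero_of_isPrim hu hu1 ?_ ?_
  · have h1 : Tendsto (fun r : ℝ => C * r) (𝓝[>] 0) (𝓝 0) := by
      have : Tendsto (fun r : ℝ => C * r) (𝓝 0) (𝓝 (C * 0)) := tendsto_id.const_mul C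
      rw [mul_zero] at this
      exact this.mono_left nhdsWithin_le_nhds
    refine squeeze_zero_norm' ?_ h1
    filter_upwards [Ioc_mem_nhdsGT one_pos] with r hr using hC r hr.1 hr.2
  · have h1 : IntegrableOn (fun r : ℝ => ((r ^ 2 * W r : ℝ) : ℂ) * (u r / r)) (Set.Ioc 0 1) := by
      refine Integrable.mul_bdd (c := C) hW.ofReal ?_ ?_
      · refine ContinuousOn.aestronglyMeasurable ?_ measurableSet_Ioc
        exact (hu.continuousOn.mono fun r hr => hr.1).div
          Complex.continuous_ofReal.continuousOn fun r hr => by exact_mod_cast hr.1.ne'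
      · filter_upwards [ae_restrict_mem measurableSet_Ioc] with r hr
        rw [norm_div, Complex.norm_real, Real.norm_of_nonneg hr.1.le, div_le_iff₀ hr.1]
        exact hC r hr.1 hr.2
    refine (h1.add hH).congr_fun (fun r hr => ?_) measurableSet_Ioc
    have hr0 : (r : ℂ) ≠ 0 := by exact_mod_cast hr.1.ne'
    simp only [Pi.add_apply]
    push_cast
    field_simp

/-- The total variation of the Wronskian of a homogeneous and an inhomogeneous solution. -/
lemma wronskian_bound {W : ℝ → ℝ} {κ : ℝ} {a a1 p p1 H : ℝ → ℂ} {α β c : ℂ} {C D : ℝ} {B : ℝ≥0∞}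
    (hW : Tendsto W atTop (𝓝 (-κ ^ 2))) (hW0 : IntegrableOn (fun r => r ^ 2 * W r) (Set.Ioc 0 1))
    (ha : IsPrim a a1) (ha1 : IsPrim a1 fun r => W r * a r)
    (hp : IsPrim p p1) (hp1 : IsPrim p1 fun r => W r * p r + H r)
    (hH : IntegrableOn (fun r : ℝ => (r : ℂ) * H r) (Set.Ioi 0))
    (hC : ∀ r, 0 < r → r ≤ 1 → ‖a r‖ ≤ C * r) (hD : ∀ r, 0 < r → r ≤ 1 → ‖p r‖ ≤ D * r)
    (hla : Tendsto (fun r => a r - waves κ α β r) atTop (𝓝 0))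
    (hlp : Tendsto (fun r => p r - waves κ c 0 r) atTop (𝓝 0))
    (hB : ∫⁻ r in Set.Ioi (0 : ℝ), ‖a r * H r‖ₑ ≤ B) :
    ‖2 * Complex.I * κ * β * c‖ₑ ≤ B := by
  have ha1' : IsPrim a1 fun r => W r * a r + 0 := ha1.congr' fun r _ => by simp
  have hwr := IsPrim.wronskian ha ha1 hp hp1
  have hla1 := tendsto_deriv_sub_waves (H := 0) hW ha ha1' (by simp) hla
  have hlp1 := tendsto_deriv_sub_waves hW hp hp1 hH hlp
  have h0a := tendsto_mul_deriv_zero (H := 0) ha ha1' hW0 (by simp) hC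
  have h0p := tendsto_mul_deriv_zero hp hp1 hW0 (hH.mono_set fun r hr => hr.1) hD
  -- The Wronskian is `(a / r) (r p1) - (p / r) (r a1)`: bounded factors times vanishing ones.
  have hzero : Tendsto (fun r => a r * p1 r - p r * a1 r) (𝓝[>] 0) (𝓝 0) := by
    have key : ∀ {q : ℝ → ℂ} {K : ℝ}, (∀ r, 0 < r → r ≤ 1 → ‖q r‖ ≤ K * r) →
        ∀ᶠ r in 𝓝[>] (0 : ℝ), ‖q r / r‖ ≤ K := by
      intro q K hq
      filter_upwards [Ioc_mem_nhdsGT one_pos] with r hr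
      rw [norm_div, Complex.norm_real, Real.norm_of_nonneg hr.1.le, div_le_iff₀ hr.1]
      exact hq r hr.1 hr.2
    have := (tendsto_mul_zero_of_bdd h0p (key hC)).sub (tendsto_mul_zero_of_bdd h0a (key hD))
    rw [sub_zero] at this
    refine this.congr' ?_
    filter_upwards [self_mem_nhdsWithin] with r hr
    have hr0 : (r : ℂ) ≠ 0 := by
      have : (0 : ℝ) < r := hr
      exact_mod_cast this.ne'
    field_simp
  -- For pure waves the outgoing parts cancel and the cross terms give `2iκβc`. Each of the six
  -- error terms contains a factor tending to zero, the other factor being bounded.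
  have hinf : Tendsto (fun r => a r * p1 r - p r * a1 r) atTop
      (𝓝 (2 * Complex.I * κ * β * c)) := by
    have hbd : ∀ γ δ : ℂ, ∀ᶠ r in (atTop : Filter ℝ), ‖waves κ γ δ r‖ ≤ ‖γ‖ + ‖δ‖ := fun γ δ =>
      Eventually.of_forall fun r => norm_waves_le κ γ δ r
    have t1 := tendsto_mul_zero_of_bdd hla (hbd (Complex.I * κ * c) (-(Complex.I * κ * 0)))
    have t2 := tendsto_mul_zero_of_bdd hlp1 (hbd α β)
    have t3 := hla.mul hlp1
    have t4 := tendsto_mul_zero_of_bdd hlp (hbd (Complex.I * κ * α) (-(Complex.I * κ * β)))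
    have t5 := tendsto_mul_zero_of_bdd hla1 (hbd c 0)
    have t6 := hlp.mul hla1
    have t := ((t1.add t2).add t3).sub ((t4.add t5).add t6)
    simp only [mul_zero, add_zero, sub_zero] at t
    have t' := t.add_const (2 * Complex.I * κ * β * c)
    rw [zero_add] at t'
    refine t'.congr fun r => ?_
    have he : Complex.exp (Complex.I * κ * r) * Complex.exp (-(Complex.I * κ * r)) = 1 := by
      rw [← Complex.exp_add, add_neg_cancel, Complex.exp_zero]
    simp only [waves]
    linear_combination (-2 * Complex.I * κ * β * c) * he
  have hle : ∀ x y : ℝ, 0 < x → x ≤ y →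
      ‖(a y * p1 y - p y * a1 y) - (a x * p1 x - p x * a1 x)‖ₑ ≤ B := by
    intro x y hx hxy
    rw [← (hwr x y hx (hx.trans_le hxy)).2, intervalIntegral.integral_of_le hxy]
    refine (enorm_integral_le_lintegral_enorm _).trans (le_trans ?_ hB)
    exact lintegral_mono_set fun t ht => hx.trans ht.1
  have hle' : ∀ y : ℝ, 0 < y → ‖a y * p1 y - p y * a1 y‖ₑ ≤ B := by
    intro y hy
    have hlim := (continuous_enorm.tendsto _).comp
      ((tendsto_const_nhds (x := a y * p1 y - p y * a1 y)).sub hzero)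
    rw [sub_zero] at hlim
    refine le_of_tendsto hlim ?_
    filter_upwards [Ioc_mem_nhdsGT hy] with x hx using hle x y hx.1 hx.2
  refine le_of_tendsto ((continuous_enorm.tendsto _).comp hinf) ?_
  filter_upwards [eventually_gt_atTop 0] with y hy using hle' y hy

/-! ### Partial wave asymptotics of the states. -/

/-- The unit vector in the direction of `k`. -/
def axis (k : Space) : Space := ‖k‖⁻¹ • k

lemma norm_axis {k : Space} (hk : k ≠ 0) : ‖axis k‖ = 1 := norm_smul_inv_norm hk

lemma cosAngle_smul_sph {k : Space} {r : ℝ} (hr : 0 < r) (z : Sph) :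
    cosAngle k (r • (z : Space)) = inner ℝ (axis k) (z : Space) := by
  rw [cosAngle, norm_smul_sph hr, inner_smul_right, axis, inner_smul_left]
  simp only [conj_trivial]
  field_simp

lemma exists_uniform_bound {G : Space → ℂ}
    (hG : G =O[Bornology.cobounded Space] fun x : Space => (‖x‖ ^ 2)⁻¹) :
    ∃ C R : ℝ, 0 < R ∧ ∀ r, R ≤ r → ∀ z : Sph, ‖(r : ℂ) * G (r • (z : Space))‖ ≤ C / r := by
  obtain ⟨C, hC⟩ := hG.bound
  obtain ⟨R, -, hR⟩ := (Metric.hasBasis_cobounded_compl_closedBall (0 : Space)).eventually_iff.1 hC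
  -- `R + 1` puts the sphere strictly outside the closed ball of radius `R`, and `1` makes the
  -- radius positive.
  refine ⟨C, max (R + 1) 1, by positivity, fun r hr z => ?_⟩
  have hr0 : 0 < r := one_pos.trans_le ((le_max_right _ _).trans hr)
  have hrR : R + 1 ≤ r := (le_max_left _ _).trans hr
  have h := hR (show r • (z : Space) ∈ (Metric.closedBall (0 : Space) R)ᶜ by
    rw [Set.mem_compl_iff, mem_closedBall_zero_iff, norm_smul_sph hr0]
    linarith)
  rw [norm_smul_sph hr0, norm_inv, norm_pow, Real.norm_of_nonneg hr0.le] at h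
  rw [norm_mul, Complex.norm_real, Real.norm_of_nonneg hr0.le]
  calc r * ‖G (r • (z : Space))‖ ≤ r * (C * (r ^ 2)⁻¹) := by gcongr
    _ = C / r := by field_simp

lemma tendsto_mul_proj_zero (n : Space) (l : ℕ) {G : Space → ℂ}
    (hG : G =O[Bornology.cobounded Space] fun x : Space => (‖x‖ ^ 2)⁻¹) :
    Tendsto (fun r : ℝ => (r : ℂ) * proj n l G r) atTop (𝓝 0) := by
  obtain ⟨C, R, hR, h⟩ := exists_uniform_bound hG
  obtain ⟨K, hK⟩ := isCompact_univ.exists_bound_of_continuousOn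
    (continuous_legendre_sph n l).continuousOn
  have hlim : Tendsto (fun r : ℝ => C / r * K * sphMeasure.real Set.univ) atTop (𝓝 0) := by
    have : Tendsto (fun r : ℝ => C / r) atTop (𝓝 0) := tendsto_const_nhds.div_atTop tendsto_id
    simpa using (this.mul_const K).mul_const (sphMeasure.real Set.univ)
  refine squeeze_zero_norm' ?_ hlim
  filter_upwards [eventually_ge_atTop R] with r hr
  rw [proj, ← integral_const_mul]
  refine norm_integral_le_of_norm_le_const (ae_of_all _ fun z => ?_)
  rw [← mul_assoc, norm_mul]
  exact mul_le_mul (h r hr z) (hK z (Set.mem_univ z)) (norm_nonneg _)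
    ((norm_nonneg _).trans (h r hr z))

/-- A meridian: a continuous choice of direction for each value of `cos θ`, along which `f` can be
read off from `ψ`. -/
lemma exists_direction {n : Space} (hn : ‖n‖ = 1) : ∃ d : ℝ → Space, Continuous d ∧
    ∀ u ∈ Set.Icc (-1 : ℝ) 1, ‖d u‖ = 1 ∧ inner ℝ n (d u) = u := by
  obtain ⟨b, hb⟩ := exists_basis hn
  have h01 : (inner ℝ n (b 1) : ℝ) = 0 := by
    rw [← hb]
    exact b.orthonormal.2 (by decide)
  have h10 : (inner ℝ (b 1) n : ℝ) = 0 := by rw [real_inner_comm, h01]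
  refine ⟨fun u => u • n + √(1 - u ^ 2) • b 1, by fun_prop, fun u hu => ⟨?_, ?_⟩⟩
  · have hu2 : 0 ≤ 1 - u ^ 2 := by nlinarith [hu.1, hu.2]
    have : ‖u • n + √(1 - u ^ 2) • b 1‖ ^ 2 = 1 := by
      rw [← real_inner_self_eq_norm_sq]
      simp only [inner_add_left, inner_add_right, inner_smul_left, inner_smul_right, h01, h10,
        real_inner_self_eq_norm_sq, hn, b.orthonormal.1 1, conj_trivial]
      have := Real.mul_self_sqrt hu2
      linear_combination this
    exact (pow_eq_one_iff_of_nonneg (norm_nonneg _) two_ne_zero).1 this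
  · rw [inner_add_right, inner_smul_right, inner_smul_right, h01, real_inner_self_eq_norm_sq, hn]
    ring

/-- The outgoing amplitude is a uniform limit of continuous functions, hence continuous. -/
lemma IsApproxScatteringState.continuousOn {k : Space} (hk : k ≠ 0) {f : ℝ → ℂ} {ψ : Space → ℂ}
    (h : IsApproxScatteringState k f ψ) : ContinuousOn f (Set.Icc (-1) 1) := by
  obtain ⟨d, hd, hd1⟩ := exists_direction (norm_axis hk)
  obtain ⟨C, R, hR, hb⟩ := exists_uniform_bound h.asymptotics
  have hpw : Continuous (planeWave k) := by
    unfold planeWave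
    fun_prop
  -- Solving the asymptotic formula for `f` along the meridian leaves an error of at most `C / r`.
  have hu : TendstoUniformlyOn (fun (r : ℝ) (u : ℝ) =>
      (r : ℂ) * Complex.exp (-(Complex.I * ‖k‖ * r)) * (ψ (r • d u) - planeWave k (r • d u)))
      f atTop (Set.Icc (-1) 1) := by
    rw [Metric.tendstoUniformlyOn_iff]
    intro ε hε
    have hlim : Tendsto (fun r : ℝ => C / r) atTop (𝓝 0) := tendsto_const_nhds.div_atTop tendsto_id
    filter_upwards [hlim.eventually_lt_const hε, eventually_ge_atTop R] with r hr1 hr2 u hu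
    have hr0 : 0 < r := hR.trans_le hr2
    have hr0' : (r : ℂ) ≠ 0 := by exact_mod_cast hr0.ne'
    let z : Sph := ⟨d u, by simpa using (hd1 u hu).1⟩
    have hz := hb r hr2 z
    rw [cosAngle_smul_sph hr0, norm_smul_sph hr0] at hz
    change ‖(r : ℂ) * (ψ (r • d u) - planeWave k (r • d u) - Complex.exp (Complex.I * ‖k‖ * r) / r
      * f (inner ℝ (axis k) (d u)))‖ ≤ C / r at hz
    rw [(hd1 u hu).2] at hz
    rw [dist_comm, dist_eq_norm]
    refine lt_of_le_of_lt (le_trans (le_of_eq ?_) hz) hr1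
    have he : Complex.exp (-(Complex.I * ‖k‖ * r)) * Complex.exp (Complex.I * ‖k‖ * r) = 1 := by
      rw [← Complex.exp_add, neg_add_cancel, Complex.exp_zero]
    rw [← one_mul ‖(r : ℂ) * _‖, ← norm_exp_neg_I ‖k‖ r, ← norm_mul]
    congr 1
    have hcancel : (r : ℂ) * (Complex.exp (Complex.I * ‖k‖ * r) / r * f u)
        = Complex.exp (Complex.I * ‖k‖ * r) * f u := by
      field_simp
    rw [mul_sub (r : ℂ), hcancel]
    linear_combination (f u) * he
  refine hu.continuousOn (Frequently.of_forall fun r => Continuous.continuousOn ?_)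
  have h1 : Continuous fun u => r • d u := by fun_prop
  exact continuous_const.mul ((h.continuous.comp h1).sub (hpw.comp h1))

/-- The coefficients of a partial wave expansion of a continuous function. -/
lemma IsPartialWaveExpansion.integral_eq {f : ℝ → ℂ} {a : ℕ → ℂ}
    (h : IsPartialWaveExpansion f a) (hf : ContinuousOn f (Set.Icc (-1) 1)) (l : ℕ) :
    ∫ t in (-1 : ℝ)..1, f t * (((legendre l).eval t : ℝ) : ℂ) = 2 * a l := by
  set S : ℕ → ℝ → ℂ := fun N u => ∑ m ∈ Finset.range N,
    (2 * (m : ℂ) + 1) * a m * (((legendre m).eval u : ℝ) : ℂ) with hS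
  have hP : ∀ m, Continuous fun u : ℝ => (((legendre m).eval u : ℝ) : ℂ) := fun m =>
    Complex.continuous_ofReal.comp (legendre m).continuous
  have hSc : ∀ N, Continuous (S N) := fun N =>
    continuous_finsetSum _ fun m _ => continuous_const.mul (hP m)
  set μ : Measure ℝ := volume.restrict (Set.Icc (-1 : ℝ) 1) with hμ
  have hle : (-1 : ℝ) ≤ 1 := by norm_num
  -- Once the partial sum contains the index `l`, orthogonality leaves `(2l+1) a_l * 2/(2l+1)`.
  have hSint : ∀ N, l < N → ∫ t in (-1 : ℝ)..1, S N t * (((legendre l).eval t : ℝ) : ℂ) = 2 * a l := by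
    intro N hN
    simp only [hS, Finset.sum_mul]
    rw [intervalIntegral.integral_finsetSum fun m _ =>
      ((continuous_const.fun_mul (hP m)).fun_mul (hP l)).intervalIntegrable _ _]
    have hterm : ∀ m : ℕ, ∫ t in (-1 : ℝ)..1, (2 * (m : ℂ) + 1) * a m
        * (((legendre m).eval t : ℝ) : ℂ) * (((legendre l).eval t : ℝ) : ℂ)
        = (2 * (m : ℂ) + 1) * a m
          * ((∫ t in (-1 : ℝ)..1, (legendre m).eval t * (legendre l).eval t : ℝ) : ℂ) := by
      intro m
      rw [← intervalIntegral.integral_ofReal, ← intervalIntegral.integral_const_mul]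
      push_cast
      simp only [mul_assoc]
    simp only [hterm]
    rw [Finset.sum_eq_single l]
    · rw [integral_legendre_sq]
      have : (2 * (l : ℂ) + 1) ≠ 0 := by
        have : (2 * (l : ℝ) + 1) ≠ 0 := by positivity
        exact_mod_cast this
      push_cast
      field_simp
    · intro m _ hm
      rw [integral_legendre_mul_of_ne hm.symm]
      simp
    · intro hn
      exact absurd (Finset.mem_range.2 hN) hn
  obtain ⟨K, hK⟩ := (isCompact_Icc (a := (-1 : ℝ)) (b := 1)).exists_bound_of_continuousOn
    (hP l).continuousOn
  have hfi : IntervalIntegrable (fun t => f t * (((legendre l).eval t : ℝ) : ℂ)) volume (-1) 1 := by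
    apply ContinuousOn.intervalIntegrable
    rw [Set.uIcc_of_le hle]
    exact hf.mul (hP l).continuousOn
  -- `P_l` is bounded by `K`, and the `L¹` norm is bounded through the `L²` norm because the
  -- interval has finite measure.
  have hbound : ∀ N, l < N →
      ‖(∫ t in (-1 : ℝ)..1, f t * (((legendre l).eval t : ℝ) : ℂ)) - 2 * a l‖ₑ
      ≤ ENNReal.ofReal K * (eLpNorm (fun u => f u - S N u) 2 μ
        * μ Set.univ ^ (1 / (1 : ℝ≥0∞).toReal - 1 / (2 : ℝ≥0∞).toReal)) := by
    intro N hN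
    rw [← hSint N hN, ← intervalIntegral.integral_sub hfi
      (((hSc N).fun_mul (hP l)).intervalIntegrable _ _), intervalIntegral.integral_of_le hle,
      ← integral_Icc_eq_integral_Ioc]
    refine (enorm_integral_le_lintegral_enorm _).trans ?_
    have hmeas : AEStronglyMeasurable (fun u => f u - S N u) μ :=
      (hf.sub (hSc N).continuousOn).aestronglyMeasurable measurableSet_Icc
    refine le_trans ?_ (mul_le_mul_right (eLpNorm_le_eLpNorm_mul_rpow_measure_univ
      (p := 1) (q := 2) (by norm_num) hmeas) _)
    rw [eLpNorm_one_eq_lintegral_enorm, ← lintegral_const_mul' _ _ ENNReal.ofReal_ne_top]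
    refine setLIntegral_mono_ae' measurableSet_Icc (ae_of_all _ fun t ht => ?_)
    rw [← sub_mul, enorm_mul, mul_comm]
    gcongr
    rw [← ofReal_norm]
    exact ENNReal.ofReal_le_ofReal (hK t ht)
  have hlim : Tendsto (fun N => ENNReal.ofReal K * (eLpNorm (fun u => f u - S N u) 2 μ
        * μ Set.univ ^ (1 / (1 : ℝ≥0∞).toReal - 1 / (2 : ℝ≥0∞).toReal))) atTop (𝓝 0) := by
    have hfin : μ Set.univ ^ (1 / (1 : ℝ≥0∞).toReal - 1 / (2 : ℝ≥0∞).toReal) ≠ ⊤ :=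
      ENNReal.rpow_ne_top_of_nonneg (by norm_num) (measure_ne_top _ _)
    have h1 := ENNReal.Tendsto.mul_const h (Or.inr hfin)
    have h2 := ENNReal.Tendsto.const_mul h1 (Or.inr (ENNReal.ofReal_ne_top (r := K)))
    simpa using h2
  have h0 : ‖(∫ t in (-1 : ℝ)..1, f t * (((legendre l).eval t : ℝ) : ℂ)) - 2 * a l‖ₑ ≤ 0 := by
    refine ge_of_tendsto hlim ?_
    filter_upwards [eventually_gt_atTop l] with N hN using hbound N hN
  exact sub_eq_zero.1 (enorm_eq_zero.1 (le_antisymm h0 bot_le))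

/-- `∫_{S²} P_l² = 4π / (2l + 1)`. -/
lemma integral_sphere_legendre_sq {n : Space} (hn : ‖n‖ = 1) (l : ℕ) :
    ∫ z : Sph, (((legendre l).eval (inner ℝ n (z : Space)) : ℝ) : ℂ)
      * (((legendre l).eval (inner ℝ n (z : Space)) : ℝ) : ℂ) ∂sphMeasure
      = ((4 * Real.pi / (2 * l + 1) : ℝ) : ℂ) := by
  have hc : Continuous fun t : ℝ => (((legendre l).eval t : ℝ) : ℂ)
      * (((legendre l).eval t : ℝ) : ℂ) := by
    have := Complex.continuous_ofReal.comp (legendre l).continuous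
    exact this.mul this
  have h := integral_sphere hn hc.continuousOn
  rw [h]
  have h2 := congrArg (fun t : ℝ => (t : ℂ)) (integral_legendre_sq l)
  simp only [← intervalIntegral.integral_ofReal, Complex.ofReal_mul] at h2
  rw [h2]
  push_cast
  ring

lemma proj_conj (n : Space) (l : ℕ) (ξ : Space → ℂ) (r : ℝ) :
    proj n l (fun x => conj (ξ x)) r = conj (proj n l ξ r) := by
  rw [proj, proj, ← integral_conj]
  simp

lemma norm_proj_le (n : Space) (l : ℕ) {ψ : Space → ℂ} (hψ : Continuous ψ) :
    ∃ C : ℝ, ∀ r : ℝ, 0 < r → r ≤ 1 → ‖(r : ℂ) * proj n l ψ r‖ ≤ C * r := by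
  obtain ⟨C, hC⟩ := (isCompact_Icc (a := (0 : ℝ)) (b := 1)).exists_bound_of_continuousOn
    (continuous_proj n l hψ).continuousOn
  refine ⟨C, fun r h0 h1 => ?_⟩
  rw [norm_mul, Complex.norm_real, Real.norm_of_nonneg h0.le, mul_comm]
  have := hC r ⟨h0.le, h1⟩
  gcongr

/-- `V → 0` is all that is needed of the decay, and `2ME = ‖k‖²`. -/
lemma tendsto_radialCoeff {M : ℝ} (hM : 0 < M) {V : ℝ → ℝ} (hV : IsShortRange V) (k : Space)
    (l : ℕ) : Tendsto (radialCoeff M V (energy M k) l) atTop (𝓝 (-‖k‖ ^ 2)) := by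
  obtain ⟨R, hR, hO⟩ := hV.decay
  have hexp : Tendsto (fun r : ℝ => Real.exp (-r / R)) atTop (𝓝 0) :=
    Real.tendsto_exp_atBot.comp ((tendsto_neg_atTop_atBot.comp tendsto_id).atBot_div_const hR)
  have hV0 := hO.trans_tendsto hexp
  have h1 : Tendsto (fun r : ℝ => (l * (l + 1) : ℝ) / r ^ 2) atTop (𝓝 0) :=
    tendsto_const_nhds.div_atTop (tendsto_pow_atTop two_ne_zero)
  have h := (h1.add (hV0.const_mul (2 * M))).sub_const (2 * M * energy M k)
  have e : (0 : ℝ) + 2 * M * 0 - 2 * M * energy M k = -‖k‖ ^ 2 := by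
    rw [energy]
    field_simp
    ring
  rw [e] at h
  exact h

lemma integrableOn_sq_mul_radialCoeff (M E : ℝ) (l : ℕ) {V : ℝ → ℝ}
    (hV : LocallyIntegrable (fun x : Space => V ‖x‖) volume) :
    IntegrableOn (fun r => r ^ 2 * radialCoeff M V E l r) (Set.Ioc 0 1) := by
  have h1 := ((integrableOn_sq_mul_potential hV 2).mono_set
    (show Set.Ioc (0 : ℝ) 1 ⊆ Set.Ioo 0 2 from fun r hr => ⟨hr.1, by linarith [hr.2]⟩)).const_mul
      (2 * M)
  have h2 : IntegrableOn (fun r : ℝ => (l * (l + 1) : ℝ) - 2 * M * E * r ^ 2) (Set.Ioc 0 1) :=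
    ((by fun_prop : Continuous fun r : ℝ =>
      (l * (l + 1) : ℝ) - 2 * M * E * r ^ 2).continuousOn.integrableOn_compact
        isCompact_Icc).mono_set Set.Ioc_subset_Icc_self
  refine IntegrableOn.congr_fun (h1.add h2) (fun r hr => ?_) measurableSet_Ioc
  have := hr.1.ne'
  simp only [Pi.add_apply, radialCoeff]
  field_simp
  ring

/-- Partial wave asymptotics of the difference of two approximate scattering states. -/
lemma tendsto_proj_sub {k : Space} (hk : k ≠ 0) {f f' : ℝ → ℂ} {ψ ψ' : Space → ℂ}
    (h : IsApproxScatteringState k f ψ) (h' : IsApproxScatteringState k f' ψ')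
    {a a' : ℕ → ℂ} (ha : IsPartialWaveExpansion f a) (ha' : IsPartialWaveExpansion f' a') (l : ℕ) :
    Tendsto (fun r : ℝ => ((r : ℂ) * proj (axis k) l ψ' r - r * proj (axis k) l ψ r)
      - waves ‖k‖ (4 * Real.pi * (a' l - a l)) 0 r) atTop (𝓝 0) := by
  set n := axis k
  have hn : ‖n‖ = 1 := norm_axis hk
  have hf := h.continuousOn hk
  have hf' := h'.continuousOn hk
  have hP : Continuous fun u : ℝ => (((legendre l).eval u : ℝ) : ℂ) :=
    Complex.continuous_ofReal.comp (legendre l).continuous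
  have hcs : Continuous fun z : Sph => (inner ℝ n (z : Space) : ℝ) := by fun_prop
  have hint : ∀ {q : Sph → ℂ}, Continuous q → Integrable q sphMeasure := fun hq =>
    hq.integrable_of_hasCompactSupport (HasCompactSupport.of_compactSpace _)
  have hamp : ∀ {g : ℝ → ℂ} {b : ℕ → ℂ}, ContinuousOn g (Set.Icc (-1) 1) →
      IsPartialWaveExpansion g b → ∫ z : Sph, g (inner ℝ n (z : Space))
        * (((legendre l).eval (inner ℝ n (z : Space)) : ℝ) : ℂ) ∂sphMeasure
        = 4 * Real.pi * b l := by
    intro g b hg hb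
    have := integral_sphere hn (hg.fun_mul hP.continuousOn)
    rw [this, hb.integral_eq hg l]
    ring
  -- The plane waves cancel in this difference, so their own partial wave expansion never enters.
  have hO := (h'.asymptotics.sub h.asymptotics)
  have hT := tendsto_mul_proj_zero n l hO
  refine hT.congr' ?_
  filter_upwards [eventually_gt_atTop 0] with r hr
  have hr0 : (r : ℂ) ≠ 0 := by exact_mod_cast hr.ne'
  set e : ℂ := Complex.exp (Complex.I * ‖k‖ * r) with he
  have hrs : Continuous fun z : Sph => r • (z : Space) := by fun_prop
  have i1 := hint ((h'.continuous.comp hrs).fun_mul (continuous_legendre_sph n l))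
  have i2 := hint ((h.continuous.comp hrs).fun_mul (continuous_legendre_sph n l))
  have i3 := hint ((hf'.comp_continuous hcs (inner_sphere_mem hn)).fun_mul
    (continuous_legendre_sph n l))
  have i4 := hint ((hf.comp_continuous hcs (inner_sphere_mem hn)).fun_mul
    (continuous_legendre_sph n l))
  simp only [Function.comp_apply] at i1 i2 i3 i4
  have i12 := i1.sub i2
  have i34 := i3.sub i4
  simp only [Pi.sub_def] at i12 i34
  have hproj : proj n l (fun x => (ψ' x - planeWave k x
        - Complex.exp (Complex.I * ‖k‖ * ‖x‖) / ‖x‖ * f' (cosAngle k x))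
        - (ψ x - planeWave k x
        - Complex.exp (Complex.I * ‖k‖ * ‖x‖) / ‖x‖ * f (cosAngle k x))) r
      = (proj n l ψ' r - proj n l ψ r) - e / r * (4 * Real.pi * a' l - 4 * Real.pi * a l) := by
    rw [← hamp hf' ha', ← hamp hf ha, proj, proj, proj, ← integral_sub i1 i2,
      ← integral_sub i3 i4, ← integral_const_mul, ← integral_sub i12 (i34.const_mul _)]
    refine integral_congr_ae (ae_of_all _ fun z => ?_)
    simp only [cosAngle_smul_sph hr, norm_smul_sph hr]
    ring
  rw [hproj, waves, ← he]
  field_simp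
  ring

/-- Partial wave asymptotics of the normalized eigenstate. -/
lemma tendsto_proj_eigenstate {k : Space} (hk : k ≠ 0) (l : ℕ) {ξ : Space → ℂ}
    (hξ : Continuous ξ) {s : ℂ}
    (hs : (fun x : Space => conj (ξ x)
        - (2 * (l : ℂ) + 1) / ‖x‖ * (((legendre l).eval (cosAngle k x) : ℝ) : ℂ)
          * ((s * Complex.exp (Complex.I * ‖k‖ * ‖x‖)
              - (-1) ^ l * Complex.exp (-(Complex.I * ‖k‖ * ‖x‖))) / (2 * Complex.I * ‖k‖)))
      =O[Bornology.cobounded Space] fun x : Space => (‖x‖ ^ 2)⁻¹) :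
    Tendsto (fun r : ℝ => conj ((r : ℂ) * proj (axis k) l ξ r)
      - waves ‖k‖ (4 * Real.pi * s / (2 * Complex.I * ‖k‖))
        (-(4 * Real.pi * (-1) ^ l / (2 * Complex.I * ‖k‖))) r) atTop (𝓝 0) := by
  set n := axis k
  have hn : ‖n‖ = 1 := norm_axis hk
  have hT := tendsto_mul_proj_zero n l hs
  refine hT.congr' ?_
  filter_upwards [eventually_gt_atTop 0] with r hr
  have hr0 : (r : ℂ) ≠ 0 := by exact_mod_cast hr.ne'
  have hk0 : (‖k‖ : ℂ) ≠ 0 := by exact_mod_cast (norm_pos_iff.2 hk).ne'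
  have hl0 : (2 * (l : ℂ) + 1) ≠ 0 := by
    have : (2 * (l : ℝ) + 1) ≠ 0 := by positivity
    exact_mod_cast this
  have hrs : Continuous fun z : Sph => r • (z : Space) := by fun_prop
  have hint : ∀ {q : Sph → ℂ}, Continuous q → Integrable q sphMeasure := fun hq =>
    hq.integrable_of_hasCompactSupport (HasCompactSupport.of_compactSpace _)
  have i1 := hint ((Complex.continuous_conj.comp (hξ.comp hrs)).fun_mul
    (continuous_legendre_sph n l))
  have i2 := hint ((continuous_legendre_sph n l).fun_mul (continuous_legendre_sph n l))
  simp only [Function.comp_apply] at i1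
  set e : ℂ := Complex.exp (Complex.I * ‖k‖ * r) with he
  set e' : ℂ := Complex.exp (-(Complex.I * ‖k‖ * r)) with he'
  -- The normalization factor `2l + 1` is cancelled by the integral `4π/(2l+1)` of `P_l²`.
  have hproj : proj n l (fun x : Space => conj (ξ x)
        - (2 * (l : ℂ) + 1) / ‖x‖ * (((legendre l).eval (cosAngle k x) : ℝ) : ℂ)
          * ((s * Complex.exp (Complex.I * ‖k‖ * ‖x‖)
              - (-1) ^ l * Complex.exp (-(Complex.I * ‖k‖ * ‖x‖))) / (2 * Complex.I * ‖k‖))) r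
      = proj n l (fun x => conj (ξ x)) r - (2 * (l : ℂ) + 1) / r
          * ((s * e - (-1) ^ l * e') / (2 * Complex.I * ‖k‖))
          * ((4 * Real.pi / (2 * l + 1) : ℝ) : ℂ) := by
    rw [← integral_sphere_legendre_sq hn, proj, proj, ← integral_const_mul,
      ← integral_sub i1 (i2.const_mul _)]
    refine integral_congr_ae (ae_of_all _ fun z => ?_)
    simp only [cosAngle_smul_sph hr, norm_smul_sph hr]
    ring
  rw [hproj, waves, ← he, ← he', map_mul, Complex.conj_ofReal, ← proj_conj]
  push_cast
  field_simp
  ring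

/-! ### The volume estimate and the conclusion. -/

/-- The volume term is controlled by `‖ξ‖_∞ ‖h‖_1`. -/
lemma lintegral_partialWave_le {M : ℝ} (hM : 0 < M) {k : Space} (hk : k ≠ 0) (l : ℕ)
    {ξ h : Space → ℂ} (hh : Measurable h) {R : ℝ → ℂ}
    (hR : ∀ x : Space, x ≠ 0 → ξ x = R ‖x‖ * (((legendre l).eval (cosAngle k x) : ℝ) : ℂ)) :
    ∫⁻ r in Set.Ioi (0 : ℝ), ‖conj ((r : ℂ) * proj (axis k) l ξ r)
        * (2 * M * (r * proj (axis k) l h r))‖ₑ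
      ≤ ENNReal.ofReal (2 * M * (4 * Real.pi / (2 * l + 1)))
        * (⨆ x : Space, ENNReal.ofReal ‖ξ x‖) * eLpNorm h 1 volume := by
  set n := axis k
  have hn : ‖n‖ = 1 := norm_axis hk
  set S := ⨆ x : Space, ENNReal.ofReal ‖ξ x‖
  have hN0 : (0 : ℝ) ≤ 4 * Real.pi / (2 * l + 1) := by positivity
  have hwave : ∀ r : ℝ, 0 < r → ∀ z : Sph, ξ (r • (z : Space))
      = R r * (((legendre l).eval (inner ℝ n (z : Space)) : ℝ) : ℂ) := by
    intro r hr z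
    have hx : r • (z : Space) ≠ 0 := by
      rw [← norm_ne_zero_iff, norm_smul_sph hr]
      exact hr.ne'
    rw [hR _ hx, norm_smul_sph hr, cosAngle_smul_sph hr]
  have hpt : ∀ r ∈ Set.Ioi (0 : ℝ), ‖conj ((r : ℂ) * proj n l ξ r)
        * (2 * M * (r * proj n l h r))‖ₑ
      ≤ ENNReal.ofReal (2 * M * (4 * Real.pi / (2 * l + 1))) * S
        * (ENNReal.ofReal (r ^ 2) * ∫⁻ z : Sph, ‖h (r • (z : Space))‖ₑ ∂sphMeasure) := by
    intro r hr
    have hr0 : 0 < r := hr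
    have hproj : proj n l ξ r = R r * ((4 * Real.pi / (2 * l + 1) : ℝ) : ℂ) := by
      rw [← integral_sphere_legendre_sq hn, proj, ← integral_const_mul]
      refine integral_congr_ae (ae_of_all _ fun z => ?_)
      simp only [hwave r hr0 z]
      ring
    -- `R r` is moved inside the integral over the sphere, where `R P_l` is `ξ` itself. This yields
    -- `‖ξ‖_∞` with no loss from estimating `P_l`.
    have hle : ‖R r‖ₑ * ‖proj n l h r‖ₑ
        ≤ S * ∫⁻ z : Sph, ‖h (r • (z : Space))‖ₑ ∂sphMeasure := by
      rw [← enorm_mul, proj, ← integral_const_mul]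
      refine (enorm_integral_le_lintegral_enorm _).trans ?_
      have hm : Measurable fun z : Sph => ‖h (r • (z : Space))‖ₑ :=
        (hh.comp (by fun_prop : Measurable fun z : Sph => r • (z : Space))).enorm
      rw [← lintegral_const_mul _ hm]
      refine lintegral_mono fun z => ?_
      have : R r * (h (r • (z : Space)) * (((legendre l).eval (inner ℝ n (z : Space)) : ℝ) : ℂ))
          = ξ (r • (z : Space)) * h (r • (z : Space)) := by
        rw [hwave r hr0 z]
        ring
      rw [this, enorm_mul]
      gcongr
      rw [← ofReal_norm]
      exact le_iSup (fun x : Space => ENNReal.ofReal ‖ξ x‖) _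
    have hnorm : ‖conj ((r : ℂ) * proj n l ξ r) * (2 * M * (r * proj n l h r))‖ₑ
        = ENNReal.ofReal (2 * M * (4 * Real.pi / (2 * l + 1))) * ENNReal.ofReal (r ^ 2)
          * (‖R r‖ₑ * ‖proj n l h r‖ₑ) := by
      rw [← ofReal_norm, ← ofReal_norm, ← ofReal_norm,
        ← ENNReal.ofReal_mul (by positivity), ← ENNReal.ofReal_mul (by positivity),
        ← ENNReal.ofReal_mul (by positivity), hproj]
      congr 1
      simp only [norm_mul, RCLike.norm_conj, Complex.norm_real, Real.norm_of_nonneg hN0,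
        Real.norm_of_nonneg hr0.le, Real.norm_of_nonneg hM.le, Complex.norm_ofNat]
      ring
    rw [hnorm]
    calc _ ≤ ENNReal.ofReal (2 * M * (4 * Real.pi / (2 * l + 1))) * ENNReal.ofReal (r ^ 2)
          * (S * ∫⁻ z : Sph, ‖h (r • (z : Space))‖ₑ ∂sphMeasure) := by gcongr
      _ = _ := by ring
  refine (setLIntegral_mono_ae' measurableSet_Ioi (ae_of_all _ hpt)).trans ?_
  rw [eLpNorm_one_eq_lintegral_enorm, lintegral_polar hh.enorm]
  rw [lintegral_const_mul]
  refine (measurable_id.pow_const 2).ennreal_ofReal.mul ?_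
  exact (hh.enorm.comp measurable_polar).lintegral_prod_left'

/-- The normalized eigenstate does not vanish identically. -/
lemma IsPartialWaveEigenstate.exists_ne_zero {M : ℝ} {V : ℝ → ℝ} {k : Space}
    (hk : k ≠ 0) {l : ℕ} {ξ : Space → ℂ}
    (hξ : IsPartialWaveEigenstate M V k l ξ) : ∃ x, ξ x ≠ 0 := by
  by_contra! h0
  obtain ⟨s, hs⟩ := hξ.normalization
  have hT := tendsto_proj_eigenstate hk l hξ.eigenstate.1 hs
  have hz : ∀ r, proj (axis k) l ξ r = 0 := fun r => by simp [proj, h0]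
  simp only [hz, mul_zero, map_zero] at hT
  -- The zero function solves the free equation, so its supposed wave asymptotics can be
  -- differentiated.
  have hprim : IsPrim (fun _ => 0) (fun _ => 0) := fun a b _ _ => by simp
  have hT1 := tendsto_deriv_sub_waves (W := fun _ => -‖k‖ ^ 2) (u := fun _ => 0) (u1 := fun _ => 0)
    (H := fun _ => 0) tendsto_const_nhds hprim (by simpa using hprim) (by simp) hT
  have hk0 : (‖k‖ : ℂ) ≠ 0 := by exact_mod_cast (norm_pos_iff.2 hk).ne'
  -- Multiplying by `iκ` and subtracting the derivative cancels the outgoing wave. What remains is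
  -- the ingoing wave, of constant modulus `4π`, which cannot tend to zero.
  have hT2 := (hT.const_mul (Complex.I * ‖k‖)).sub hT1
  rw [mul_zero, sub_zero] at hT2
  have hT3 := hT2.norm
  have hconst : ∀ r : ℝ, ‖Complex.I * ‖k‖ * (0 - waves ‖k‖ (4 * Real.pi * s / (2 * Complex.I * ‖k‖))
        (-(4 * Real.pi * (-1) ^ l / (2 * Complex.I * ‖k‖))) r)
      - (0 - waves ‖k‖ (Complex.I * ‖k‖ * (4 * Real.pi * s / (2 * Complex.I * ‖k‖)))
        (-(Complex.I * ‖k‖ * (-(4 * Real.pi * (-1) ^ l / (2 * Complex.I * ‖k‖))))) r)‖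
      = 4 * Real.pi := by
    intro r
    have e : Complex.I * ‖k‖ * (0 - waves ‖k‖ (4 * Real.pi * s / (2 * Complex.I * ‖k‖))
        (-(4 * Real.pi * (-1) ^ l / (2 * Complex.I * ‖k‖))) r)
      - (0 - waves ‖k‖ (Complex.I * ‖k‖ * (4 * Real.pi * s / (2 * Complex.I * ‖k‖)))
        (-(Complex.I * ‖k‖ * (-(4 * Real.pi * (-1) ^ l / (2 * Complex.I * ‖k‖))))) r)
      = ((4 * Real.pi : ℝ) : ℂ) * (-1) ^ l * Complex.exp (-(Complex.I * ‖k‖ * r)) := by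
      simp only [waves]
      have := Complex.I_ne_zero
      push_cast
      field_simp
      ring
    rw [e, norm_mul, norm_mul, norm_exp_neg_I, norm_pow, norm_neg, norm_one, one_pow,
      Complex.norm_real, Real.norm_of_nonneg (by positivity), mul_one, mul_one]
  simp only [hconst, norm_zero] at hT3
  have := tendsto_nhds_unique hT3 tendsto_const_nhds
  have hpi := Real.pi_pos
  linarith

/-- The Wronskian bound for `ξ*` and `ψ' - ψ`. Integrability of `h` is what makes the derivative
asymptotics of the inhomogeneous solution available. -/
lemma stability_of_integrable {M : ℝ} (hM : 0 < M) {V : ℝ → ℝ} (hV : IsShortRange V)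
    {k : Space} (hk : k ≠ 0) {ψ ψ' : Space → ℂ} {f f' : ℝ → ℂ}
    (hψ : IsScatteringState M V k f ψ) (hψ' : IsApproxScatteringState k f' ψ')
    {a a' : ℕ → ℂ} (ha : IsPartialWaveExpansion f a) (ha' : IsPartialWaveExpansion f' a')
    {h : Space → ℂ} (hmeas : Measurable h) (hint : Integrable h)
    (hh : HasSchrodingerViolation M V (energy M k) ψ' h) {l : ℕ} {ξ : Space → ℂ}
    (hξ : IsPartialWaveEigenstate M V k l ξ) :
    ENNReal.ofReal ‖a l - a' l‖ ≤ ENNReal.ofReal (M / (2 * Real.pi * (2 * (l : ℝ) + 1))) *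
        (⨆ x : Space, ENNReal.ofReal ‖ξ x‖) * eLpNorm h 1 volume := by
  have hn := norm_axis hk
  obtain ⟨s, hs⟩ := hξ.normalization
  obtain ⟨R, hR⟩ := hξ.partialWave
  have hVl := hV.locallyIntegrable
  obtain ⟨u1, hu, hu1⟩ := exists_radial_equation hM hVl (energy M k) hn l hξ.eigenstate.1
    hξ.eigenstate.2
  obtain ⟨A1, hA, hA1⟩ := exists_radial_equation hM hVl (energy M k) hn l hψ.1.continuous hψ.2.2
  obtain ⟨B1, hB, hB1⟩ := exists_radial_equation hM hVl (energy M k) hn l hψ'.continuous hh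
  have hz : ∀ r, proj (axis k) l (0 : Space → ℂ) r = 0 := fun r => by simp [proj]
  simp only [hz, mul_zero, add_zero] at hu1 hA1
  set W := radialCoeff M V (energy M k) l
  have hp := hB.sub hA
  have hp1 := (hB1.sub hA1).congr' (w' := fun r => (W r : ℂ) * ((r : ℂ) * proj (axis k) l ψ' r
      - r * proj (axis k) l ψ r) + 2 * M * (r * proj (axis k) l h r)) fun r _ => by ring
  -- The radial coefficient is real, so the conjugate solves the same equation; it is `ξ*` whose
  -- ingoing wave is normalized.
  have hq1 := hu1.conj.congr' (w' := fun r => (W r : ℂ) * conj ((r : ℂ) * proj (axis k) l ξ r))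
    fun r _ => by rw [map_mul, Complex.conj_ofReal]
  have hH : IntegrableOn (fun r : ℝ => (r : ℂ) * (2 * M * (r * proj (axis k) l h r)))
      (Set.Ioi 0) := by
    refine ((integrableOn_proj (n := axis k) l hint).const_mul (2 * (M : ℂ))).congr
      (ae_of_all _ fun r => ?_)
    simp only
    ring
  obtain ⟨C, hC⟩ := norm_proj_le (axis k) l hξ.eigenstate.1
  obtain ⟨D, hD⟩ := norm_proj_le (axis k) l hψ.1.continuous
  obtain ⟨D', hD'⟩ := norm_proj_le (axis k) l hψ'.continuous
  have key := wronskian_bound (C := C) (D := D' + D) (tendsto_radialCoeff hM hV k l)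
    (integrableOn_sq_mul_radialCoeff M (energy M k) l hVl) hu.conj hq1 hp hp1 hH
    (fun r h0 h1 => by rw [RCLike.norm_conj]; exact hC r h0 h1)
    (fun r h0 h1 => (norm_sub_le _ _).trans (by
      rw [add_mul]
      exact add_le_add (hD' r h0 h1) (hD r h0 h1)))
    (tendsto_proj_eigenstate hk l hξ.eigenstate.1 hs)
    (tendsto_proj_sub hk hψ.1 hψ' ha ha' l)
    (lintegral_partialWave_le hM hk l hmeas hR)
  have hk0 : (‖k‖ : ℂ) ≠ 0 := by exact_mod_cast (norm_pos_iff.2 hk).ne'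
  -- The limit `2iκβc` of the Wronskian at infinity, with `β` the ingoing coefficient of `ξ*` and
  -- `c` the outgoing one of `ψ' - ψ`.
  have hval : 2 * Complex.I * ‖k‖ * (-(4 * Real.pi * (-1) ^ l / (2 * Complex.I * ‖k‖)))
      * (4 * Real.pi * (a' l - a l))
      = ((16 * Real.pi ^ 2 : ℝ) : ℂ) * (-1) ^ l * (a l - a' l) := by
    have := Complex.I_ne_zero
    push_cast
    field_simp
    ring
  rw [hval, ← ofReal_norm, norm_mul, norm_mul, norm_pow, norm_neg, norm_one, one_pow,
    mul_one, Complex.norm_real, Real.norm_of_nonneg (by positivity)] at key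
  have hpi := Real.pi_pos
  have e1 : ‖a l - a' l‖ = (16 * Real.pi ^ 2)⁻¹ * (16 * Real.pi ^ 2 * ‖a l - a' l‖) := by
    field_simp
  have e2 : M / (2 * Real.pi * (2 * (l : ℝ) + 1))
      = (16 * Real.pi ^ 2)⁻¹ * (2 * M * (4 * Real.pi / (2 * l + 1))) := by
    field_simp
    norm_num
  rw [e1, e2, ENNReal.ofReal_mul (by positivity), ENNReal.ofReal_mul (p := (16 * Real.pi ^ 2)⁻¹)
    (by positivity), mul_assoc (ENNReal.ofReal (16 * Real.pi ^ 2)⁻¹),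
    mul_assoc (ENNReal.ofReal (16 * Real.pi ^ 2)⁻¹)]
  gcongr

end Scattering

end

theorem mainTheorem3 (M : ℝ) (hM : 0 < M) (V : ℝ → ℝ) (hV : Scattering.IsShortRange V)
    (k : Scattering.Space) (hk : k ≠ 0)
    (ψ ψ' : Scattering.Space → ℂ) (f f' : ℝ → ℂ)
    (hψ : Scattering.IsScatteringState M V k f ψ)
    (hψ' : Scattering.IsApproxScatteringState k f' ψ')
    (a a' : ℕ → ℂ)
    (ha : Scattering.IsPartialWaveExpansion f a)
    (ha' : Scattering.IsPartialWaveExpansion f' a')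
    (h : Scattering.Space → ℂ)
    (hh : Scattering.HasSchrodingerViolation M V (Scattering.energy M k) ψ' h)
    (l : ℕ) (ξ : Scattering.Space → ℂ)
    (hξ : Scattering.IsPartialWaveEigenstate M V k l ξ) :
    ENNReal.ofReal ‖a l - a' l‖ ≤
      ENNReal.ofReal (M / (2 * Real.pi * (2 * (l : ℝ) + 1))) *
        (⨆ x : Scattering.Space, ENNReal.ofReal ‖ξ x‖) *
        eLpNorm h 1 (volume : Measure Scattering.Space) := by
  have hsm := hh.1.aestronglyMeasurable
  -- In `ℝ≥0∞` one has `0 * ⊤ = 0`, so for a non-integrable violation the right-hand side is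
  -- infinite only because the prefactors do not vanish.
  by_cases hfin : eLpNorm h 1 (volume : Measure Scattering.Space) = ⊤
  · obtain ⟨x, hx⟩ := hξ.exists_ne_zero hk
    have h1 : ENNReal.ofReal (M / (2 * Real.pi * (2 * (l : ℝ) + 1))) ≠ 0 := by
      rw [Ne, ENNReal.ofReal_eq_zero, not_le]
      positivity
    have h2 : (⨆ x : Scattering.Space, ENNReal.ofReal ‖ξ x‖) ≠ 0 := by
      intro h0
      have := (le_iSup (fun x : Scattering.Space => ENNReal.ofReal ‖ξ x‖) x).trans h0.le
      rw [nonpos_iff_eq_zero, ENNReal.ofReal_eq_zero] at this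
      exact hx (norm_le_zero_iff.1 this)
    rw [hfin, ENNReal.mul_top (mul_ne_zero h1 h2)]
    exact le_top
  · have hmk := hsm.ae_eq_mk
    have hint : Integrable h := memLp_one_iff_integrable.1 ⟨hsm, lt_top_iff_ne_top.2 hfin⟩
    have hint' : Integrable (hsm.mk h) := hint.congr hmk
    rw [eLpNorm_congr_ae hmk]
    -- `h` is replaced by a measurable representative, so that its restrictions to all spheres are
    -- measurable; neither the distributional equation nor the norm changes.
    refine Scattering.stability_of_integrable hM hV hk hψ hψ' ha ha'
      hsm.stronglyMeasurable_mk.measurable hint' ⟨hint'.locallyIntegrable, fun g hg hgc => ?_⟩ hξ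
    rw [hh.2 g hg hgc]
    refine integral_congr_ae ?_
    filter_upwards [hmk] with x hx
    rw [hx]
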